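/- Let $k$ be a field of characteristic $p>0$ and let $R=\bigoplus_{n\ge 0}R_n$ be a standard graded Noetherian $k$-algebra (so $R\neq 0$, $R_0=k$, and $R$ is generated over $k$ by the finite-dimensional space $R_1$), with homogeneous maximal ideal $\mathfrak m=\bigoplus_{n>0}R_n$. For $q=p^e$ and an ideal $I$, let $I^{[q]}$ be the ideal generated by the $q$-th powers of the elements of $I$. For a homogeneous $\mathfrak m$-primary ideal $\mathfrak a$ put $\operatorname{t.s.d.}(R/\mathfrak a)=\max\{n : (R/\mathfrak a)_n\neq 0\}$, and for a homogeneous $\mathfrak m$-primary ideal $I$ define the diagonal $F$-threshold $$c^I(R)=\lim_{e\to\infty}\frac{\operatorname{t.s.d.}(R/I^{[p^e]})}{p^e}$$ whenever this limit exists in $\mathbb R$; write $c(R)=c^{\mathfrak m}(R)$. Call $R$ a complete intersection if it is isomorphic, as a graded $k$-algebra, to $S/(f_1,\dots,f_t)$ with $S=k[x_1,\dots,x_n]$ standard graded and $f_1,\dots,f_t$ a regular sequence of homogeneous elements of $S$. Call $R$ $F$-pure on the punctured spectrum if for every prime $P\neq\mathfrak m$ of $R$ the Frobenius endomorphism of $R_P$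 is pure. **Proposition.** Let $I$ be a homogeneous $\mathfrak m$-primary ideal of $R$. 1. If $R$ is a complete intersection or is $F$-pure on the punctured spectrum, then $c^I(R)$ exists. 2. If $R= S/(f_1,\dots,f_t)$ is a complete intersection, presented as above, and $J\subseteq S$ is the preimage of $I$, then $c^I(R)$ and $c^J(S)$ exist and $$c^I(R)\ \ge\ c^J(S)-\sum_{i=1}^t\deg f_i .$$ 3. In particular, if $R$ is a complete intersection, then $c(R)\ge -a(R)$, where the $a$-invariant $a(R)$ is the largest integer $j$ with $\bigl(H^{\dim R}_{\mathfrak m}(R)\bigr)_j\neq 0$. -/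

import Mathlib

open Filter Topology
open scoped TensorProduct

universe u v

namespace DiagF

/-! ### Standard graded algebras, Frobenius powers, top socle degree -/

section Graded

variable {k : Type v} [Field k] {R : Type u} [CommRing R] [Algebra k R]

/-- A (nonzero) standard graded Noetherian algebra over the field `k`: the degree zero part is `k`,
and the algebra is generated over `k` by its finite-dimensional degree one part. -/
structure IsStandardGraded (𝒜 : ℕ → Submodule k R) [GradedAlgebra 𝒜] : Prop where
  nontrivial : Nontrivial R
  zero_eq : 𝒜 0 = 1
  finite_one : Module.Finite k (𝒜 1)
  adjoin_one : Algebra.adjoin k (𝒜 1 : Set R) = ⊤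

/-- The homogeneous maximal ideal `𝔪 = ⨁_{n > 0} R_n`. -/
def maxIdeal (𝒜 : ℕ → Submodule k R) [GradedAlgebra 𝒜] : Ideal R :=
  (HomogeneousIdeal.irrelevant 𝒜).toIdeal

/-- `t.s.d.(R/𝔞) = max {n | (R/𝔞)_n ≠ 0}`, where `(R/𝔞)_n` is the image of `R_n`. It is used only
for proper homogeneous ideals `𝔞` primary to the homogeneous maximal ideal, for which the set is
nonempty and bounded. -/
noncomputable def topSocleDegree (𝒜 : ℕ → Submodule k R) (𝔞 : Ideal R) : ℕ :=
  sSup {n | (𝒜 n).map (Ideal.Quotient.mkₐ k 𝔞).toLinearMap ≠ ⊥}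

end Graded

/-- The Frobenius power `I^{[q]}`, the ideal generated by the `q`-th powers of elements of `I`. -/
def frobeniusPower {R : Type u} [CommRing R] (I : Ideal R) (q : ℕ) : Ideal R :=
  Ideal.span ((fun r => r ^ q) '' (I : Set R))

/-- The diagonal `F`-threshold `c^I(R) = lim_e t.s.d.(R/I^{[p^e]}) / p^e` exists and equals `c`. -/
def HasDiagonalFThreshold {k : Type v} [Field k] {R : Type u} [CommRing R] [Algebra k R]
    (p : ℕ) (𝒜 : ℕ → Submodule k R) (I : Ideal R) (c : ℝ) : Prop :=
  Tendsto (fun e : ℕ => (topSocleDegree 𝒜 (frobeniusPower I (p ^ e)) : ℝ) / (p : ℝ) ^ e)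
    atTop (𝓝 c)

/-! ### `F`-purity -/

/-- A ring homomorphism `A → B` is pure if `M → B ⊗_A M` is injective for every `A`-module `M`.
(Modules in the universe of `A` suffice, since purity is tested on finitely generated modules.) -/
def IsPureHom {A B : Type u} [CommRing A] [CommRing B] (φ : A →+* B) : Prop :=
  letI : Algebra A B := φ.toAlgebra
  ∀ (M : Type u) [AddCommGroup M] [Module A M], Function.Injective fun m : M => (1 : B) ⊗ₜ[A] m

/-- `A` is an `F`-pure ring of characteristic `p`: its Frobenius endomorphism is pure. -/
def IsFPure (p : ℕ) [Fact p.Prime] (A : Type u) [CommRing A] : Prop :=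
  ∃ _ : CharP A p, IsPureHom (frobenius A p)

/-- `R_P` is `F`-pure for every prime ideal `P` other than the homogeneous maximal ideal. -/
def IsFPureOnPuncturedSpectrum (p : ℕ) [Fact p.Prime] {k : Type v} [Field k] {R : Type u}
    [CommRing R] [Algebra k R] (𝒜 : ℕ → Submodule k R) [GradedAlgebra 𝒜] : Prop :=
  ∀ (P : Ideal R) [P.IsPrime], P ≠ maxIdeal 𝒜 → IsFPure p (Localization.AtPrime P)

/-! ### Complete intersections -/

section CompleteIntersection

variable {k : Type v} [Field k] {R : Type u} [CommRing R] [Algebra k R]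

/-- `φ` presents the graded algebra `R` as `S/(f_1, …, f_t)`, where `S = k[x_1, …, x_n]` with its
standard grading and `f_1, …, f_t` is a regular sequence with `f_i` homogeneous of degree `d_i`. -/
structure IsCIPresentation (𝒜 : ℕ → Submodule k R) {n t : ℕ}
    (φ : MvPolynomial (Fin n) k →ₐ[k] R) (f : Fin t → MvPolynomial (Fin n) k) (d : Fin t → ℕ) :
    Prop where
  surjective : Function.Surjective φ
  map_X : ∀ i, φ (MvPolynomial.X i) ∈ 𝒜 1
  ker_eq : RingHom.ker φ = Ideal.span (Set.range f)
  homogeneous : ∀ i, (f i).IsHomogeneous (d i)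
  regular : RingTheory.Sequence.IsRegular (MvPolynomial (Fin n) k) (List.ofFn f)

/-- The standard graded algebra `R` is a complete intersection. -/
def IsCompleteIntersection (𝒜 : ℕ → Submodule k R) : Prop :=
  ∃ (n t : ℕ) (φ : MvPolynomial (Fin n) k →ₐ[k] R) (f : Fin t → MvPolynomial (Fin n) k)
    (d : Fin t → ℕ), IsCIPresentation 𝒜 φ f d

end CompleteIntersection

/-! ### Graded local cohomology through the Čech complex, and the `a`-invariant -/

/-- The canonical map `A_a → A_b` when `a ∣ b`. -/
noncomputable def awayMap {A : Type u} [CommRing A] {a b : A} (h : a ∣ b) :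
    Localization.Away a →+* Localization.Away b :=
  IsLocalization.Away.lift (S := Localization.Away a) (g := algebraMap A (Localization.Away b)) a
    (isUnit_of_dvd_unit (map_dvd (algebraMap A (Localization.Away b)) h)
      (IsLocalization.Away.algebraMap_isUnit b))

section Cech

variable {k : Type v} [Field k] {R : Type u} [CommRing R] [Algebra k R]

/-- The grading extended to integer degrees by zero. -/
def intPiece (𝒜 : ℕ → Submodule k R) (m : ℤ) : Submodule k R :=
  if 0 ≤ m then 𝒜 m.toNat else ⊥

theorem intPiece_mul (𝒜 : ℕ → Submodule k R) [GradedAlgebra 𝒜] {m : ℤ} {n : ℕ} {a b : R}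
    (ha : a ∈ intPiece 𝒜 m) (hb : b ∈ 𝒜 n) : a * b ∈ intPiece 𝒜 (m + n) := by
  unfold intPiece at *
  split_ifs at ha with h
  · rw [if_pos (by omega)]
    have h1 : (m + n).toNat = m.toNat + n := by omega
    rw [h1]
    exact SetLike.mul_mem_graded ha hb
  · rw [Submodule.mem_bot] at ha
    simp [ha]

variable (𝒜 : ℕ → Submodule k R) {n : ℕ} (x : Fin n → 𝒜 1)

/-- The product of the `x_i`, `i ∈ s`. -/
def cechProd (s : Finset (Fin n)) : R := ∏ i ∈ s, (x i : R)

/-- The localization `R_{x_s}`, where `x_s = ∏_{i ∈ s} x_i`. -/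
abbrev CechLoc (s : Finset (Fin n)) : Type u := Localization.Away (cechProd 𝒜 x s)

theorem cechProd_mem [GradedAlgebra 𝒜] (s : Finset (Fin n)) : cechProd 𝒜 x s ∈ 𝒜 s.card := by
  have h := SetLike.prod_mem_graded 𝒜 (fun _ => 1) (fun i => (x i : R)) (F := s)
    (fun i _ => (x i).2)
  simpa [cechProd] using h

theorem cechProd_erase_dvd (s : Finset (Fin n)) (i : Fin n) :
    cechProd 𝒜 x (s.erase i) ∣ cechProd 𝒜 x s :=
  Finset.prod_dvd_prod_of_subset _ _ _ (Finset.erase_subset i s)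

/-- The degree `j` part of `R_{x_s}`: the fractions `a / x_s ^ N` with `a` homogeneous of degree
`j + N |s|`. -/
def cechLocPiece [GradedAlgebra 𝒜] (s : Finset (Fin n)) (j : ℤ) : AddSubgroup (CechLoc 𝒜 x s) where
  carrier := {z | ∃ N : ℕ, ∃ a ∈ intPiece 𝒜 (j + N * s.card),
    z * algebraMap R _ (cechProd 𝒜 x s ^ N) = algebraMap R _ a}
  zero_mem' := ⟨0, 0, Submodule.zero_mem _, by simp⟩
  neg_mem' := by
    rintro z ⟨N, a, ha, hz⟩
    exact ⟨N, -a, Submodule.neg_mem _ ha, by rw [neg_mul, hz, map_neg]⟩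
  add_mem' := by
    rintro z w ⟨N, a, ha, hz⟩ ⟨M, b, hb, hw⟩
    refine ⟨N + M, a * cechProd 𝒜 x s ^ M + b * cechProd 𝒜 x s ^ N, Submodule.add_mem _ ?_ ?_, ?_⟩
    · have h := intPiece_mul 𝒜 ha (SetLike.pow_mem_graded M (cechProd_mem 𝒜 x s))
      convert h using 2
      push_cast [smul_eq_mul]
      ring
    · have h := intPiece_mul 𝒜 hb (SetLike.pow_mem_graded N (cechProd_mem 𝒜 x s))
      convert h using 2
      push_cast [smul_eq_mul]
      ring
    · rw [map_add, map_mul, map_mul, ← hz, ← hw, pow_add, map_mul]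
      ring

/-- The Čech differential on the direct sum (over all cohomological degrees) of the Čech complex
`⨁_s R_{x_s}`: `(d c)_s = ∑_{i ∈ s} (-1) ^ #{l ∈ s | l < i} c_{s \ {i}}`. -/
noncomputable def cechD :
    (∀ s : Finset (Fin n), CechLoc 𝒜 x s) →+ (∀ s : Finset (Fin n), CechLoc 𝒜 x s) where
  toFun c s := ∑ i ∈ s, (-1) ^ (s.filter (· < i)).card *
    awayMap (cechProd_erase_dvd 𝒜 x s i) (c (s.erase i))
  map_zero' := by
    funext s
    simp
  map_add' c c' := by
    funext s
    simp [mul_add, Finset.sum_add_distrib]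

variable [GradedAlgebra 𝒜]

/-- The degree `j` part of the `i`-th term `⨁_{|s| = i} R_{x_s}` of the Čech complex. -/
def cechCochains (i : ℕ) (j : ℤ) : AddSubgroup (∀ s : Finset (Fin n), CechLoc 𝒜 x s) where
  carrier := {c | (∀ s, c s ∈ cechLocPiece 𝒜 x s j) ∧ ∀ s, s.card ≠ i → c s = 0}
  zero_mem' := ⟨fun s => (cechLocPiece 𝒜 x s j).zero_mem, fun _ _ => rfl⟩
  neg_mem' := by
    rintro c ⟨h1, h2⟩
    exact ⟨fun s => (cechLocPiece 𝒜 x s j).neg_mem (h1 s), fun s hs => by simp [h2 s hs]⟩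
  add_mem' := by
    rintro c c' ⟨h1, h2⟩ ⟨h1', h2'⟩
    exact ⟨fun s => (cechLocPiece 𝒜 x s j).add_mem (h1 s) (h1' s),
      fun s hs => by simp [h2 s hs, h2' s hs]⟩

/-- Čech cocycles of cohomological degree `i` and internal degree `j`. -/
noncomputable def cechCocycles (i : ℕ) (j : ℤ) :
    AddSubgroup (∀ s : Finset (Fin n), CechLoc 𝒜 x s) :=
  cechCochains 𝒜 x i j ⊓ (cechD 𝒜 x).ker

/-- Čech coboundaries of cohomological degree `i` and internal degree `j`. -/
noncomputable def cechCoboundaries :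
    ℕ → ℤ → AddSubgroup (∀ s : Finset (Fin n), CechLoc 𝒜 x s)
  | 0, _ => ⊥
  | i + 1, j => (cechCochains 𝒜 x i j).map (cechD 𝒜 x)

/-- The degree `j` part of the `i`-th Čech cohomology of `R` with respect to `x_1, …, x_n`. When
these generate `𝔪` (up to radical) it is `(H^i_𝔪(R))_j`. -/
abbrev CechCohomology (i : ℕ) (j : ℤ) : Type u :=
  cechCocycles 𝒜 x i j ⧸ (cechCoboundaries 𝒜 x i j).addSubgroupOf (cechCocycles 𝒜 x i j)

end Cech

/-- `a` is the `a`-invariant of `R`, the largest integer `j` with `(H^{dim R}_𝔪(R))_j ≠ 0`. The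
local cohomology is computed by the Čech complex on a finite family of linear forms generating `𝔪`;
it does not depend on the family. -/
def IsAInvariant {k : Type v} [Field k] {R : Type u} [CommRing R] [Algebra k R]
    (𝒜 : ℕ → Submodule k R) [GradedAlgebra 𝒜] (a : ℤ) : Prop :=
  ∃ (n : ℕ) (x : Fin n → 𝒜 1) (D : ℕ),
    Ideal.span (Set.range fun i => (x i : R)) = maxIdeal 𝒜 ∧ ringKrullDim R = D ∧
      IsGreatest {j : ℤ | Nontrivial (CechCohomology 𝒜 x D j)} a

end DiagF

/-! Present `R` as a quotient of `S = k[x_1, …, x_n]` and write `T` for t.s.d.`(R/I^{[q]})`. A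
monomial of degree greater than `pT + np` is divisible by the `p`-th power of a monomial of degree
greater than `T`: divide every exponent by `p` and round down. Hence t.s.d.`(R/I^{[pq]}) ≤ pT + np`,
so t.s.d.`/q` is nonincreasing up to a correction that tends to zero, and the limit exists
(`topSocleDegree_frobeniusPower_succ_le`, `exists_tendsto_div_pow`).

For `R = S/(f_1, …, f_t)` the preimage of `I^{[q]}` is `J^{[q]} + (f)`, and each `f_i^q` lies in
`J^{[q]}`. Modulo `J^{[q]}`, a form of degree greater than `T` is a combination of the `f_i`, and
its cofactors can be rewritten in the same way while their degree exceeds `T`. Starting above degree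
`T + q ∑ deg f_i`, this continues until some `f_i` occurs to the power `q`. Dividing by `q` gives
the comparison (`piece_le_of_piece_le_sup`).

For `I = 𝔪`, the monomial `∏ x_i^{q-1}` shows `c(S) ≥ n`, so it remains to prove `a(R) = ∑ deg f_i -
n`. The Čech complex of `S` lives in the Laurent polynomials and splits by exponent vector; an
exponent with a nonnegative coordinate contributes nothing, and the top surviving class is `1/(x_1 ⋯
x_n)` in degree `-n`. Each `f_i` raises the top degree by `deg f_i`, by the long exact sequence of
multiplication by `f_i`, carried out on explicit lifts (`cechVanishes_sup`, `not_cechVanishes_sup`).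
The equality `dim R = n - t` (`ringKrullDim_eq`) puts this class in the right cohomological degree.
-/

namespace DiagF

/-! ### Graded surjections from a polynomial ring. -/

section GradedMap

noncomputable instance gradedAlgebraMvPolynomial (k : Type v) [Field k] (n : ℕ) :
    GradedAlgebra (MvPolynomial.homogeneousSubmodule (Fin n) k) :=
  MvPolynomial.gradedAlgebra

variable {k : Type v} [Field k] {R : Type u} [CommRing R] [Algebra k R]
  (𝒜 : ℕ → Submodule k R) [GradedAlgebra 𝒜] {n : ℕ} {φ : MvPolynomial (Fin n) k →ₐ[k] R}

open MvPolynomial DirectSum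

theorem prod_pow_mem (hX : ∀ i, φ (X i) ∈ 𝒜 1) (α : Fin n → ℕ) :
    ∏ i, φ (X i) ^ α i ∈ 𝒜 (∑ i, α i) := by
  have h := SetLike.prod_pow_mem_graded 𝒜 (fun _ => 1) (fun i => φ (X i)) (F := Finset.univ) α
    (fun i _ => hX i)
  simpa using h

theorem map_monomial (α : Fin n →₀ ℕ) (c : k) :
    φ (monomial α c) = c • ∏ i, φ (X i) ^ α i := by
  rw [monomial_eq, map_mul, Finsupp.prod_fintype _ _ (fun i => pow_zero _), map_prod,
    ← MvPolynomial.algebraMap_eq, AlgHom.commutes, Algebra.smul_def]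
  simp

theorem map_mem_piece (hX : ∀ i, φ (X i) ∈ 𝒜 1) {m : ℕ} {a : MvPolynomial (Fin n) k}
    (ha : a ∈ homogeneousSubmodule (Fin n) k m) : φ a ∈ 𝒜 m := by
  rw [← support_sum_monomial_coeff a, map_sum]
  refine Submodule.sum_mem _ fun α hα => ?_
  rw [map_monomial]
  refine Submodule.smul_mem _ _ ?_
  have h := prod_pow_mem 𝒜 hX α
  have h2 : ∑ i, α i = m := by
    have := (mem_homogeneousSubmodule m a).1 ha (mem_support_iff.1 hα)
    rw [← this, Finsupp.weight_apply, Finsupp.sum_fintype _ _ (by simp)]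
    simp
  rwa [h2] at h

/-- Each component of `a` lands in the piece of its own degree, so the images of the components are
already the decomposition of `φ a`. -/
theorem decompose_map (hX : ∀ i, φ (X i) ∈ 𝒜 1) (a : MvPolynomial (Fin n) k) (m : ℕ) :
    (decompose 𝒜 (φ a) m : R) =
      φ (decompose (homogeneousSubmodule (Fin n) k) a m : MvPolynomial (Fin n) k) := by
  classical
  conv_lhs => rw [← sum_support_decompose (homogeneousSubmodule (Fin n) k) a, map_sum,
    decompose_sum, DFinsupp.finsetSum_apply, AddSubmonoidClass.coe_finsetSum]
  rw [Finset.sum_eq_single m]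
  · rw [decompose_of_mem_same 𝒜 (map_mem_piece 𝒜 hX (SetLike.coe_mem _))]
  · intro b _ hb
    exact decompose_of_mem_ne 𝒜 (map_mem_piece 𝒜 hX (SetLike.coe_mem _)) hb
  · intro hm
    simp only [DFinsupp.mem_support_toFun, not_not] at hm
    simp [hm]

theorem exists_preimage_piece (hφ : Function.Surjective φ) (hX : ∀ i, φ (X i) ∈ 𝒜 1) {m : ℕ}
    {r : R} (hr : r ∈ 𝒜 m) : ∃ a ∈ homogeneousSubmodule (Fin n) k m, φ a = r := by
  obtain ⟨a, rfl⟩ := hφ r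
  exact ⟨_, SetLike.coe_mem (decompose (homogeneousSubmodule (Fin n) k) a m),
    by rw [← decompose_map 𝒜 hX, decompose_of_mem_same 𝒜 hr]⟩

theorem isHomogeneous_comap (hX : ∀ i, φ (X i) ∈ 𝒜 1) {I : Ideal R} (hI : I.IsHomogeneous 𝒜) :
    (I.comap φ).IsHomogeneous (homogeneousSubmodule (Fin n) k) := by
  intro i a ha
  rw [Ideal.mem_comap] at ha ⊢
  rw [← decompose_map 𝒜 hX]
  exact hI i ha

/-- A graded piece is contained in an ideal as soon as all monomials of that degree are. -/
theorem piece_le_of_monomials (hφ : Function.Surjective φ) (hX : ∀ i, φ (X i) ∈ 𝒜 1) {m : ℕ}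
    {𝔞 : Ideal R} (h : ∀ α : Fin n → ℕ, ∑ i, α i = m → ∏ i, φ (X i) ^ α i ∈ 𝔞) {r : R}
    (hr : r ∈ 𝒜 m) : r ∈ 𝔞 := by
  obtain ⟨a, ha, rfl⟩ := exists_preimage_piece 𝒜 hφ hX hr
  rw [← support_sum_monomial_coeff a, map_sum]
  refine Ideal.sum_mem _ fun α hα => ?_
  rw [map_monomial, Algebra.smul_def]
  refine Ideal.mul_mem_left _ _ (h _ ?_)
  have := (mem_homogeneousSubmodule m a).1 ha (mem_support_iff.1 hα)
  rw [← this, Finsupp.weight_apply, Finsupp.sum_fintype _ _ (by simp)]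
  simp

theorem map_X_mem_maxIdeal (hX : ∀ i, φ (X i) ∈ 𝒜 1) (i : Fin n) : φ (X i) ∈ maxIdeal 𝒜 :=
  HomogeneousIdeal.mem_irrelevant_of_mem 𝒜 one_pos (hX i)

theorem span_map_X (hφ : Function.Surjective φ) (hX : ∀ i, φ (X i) ∈ 𝒜 1) :
    Ideal.span (Set.range fun i => φ (X i)) = maxIdeal 𝒜 := by
  apply le_antisymm
  · rw [Ideal.span_le]
    rintro _ ⟨i, rfl⟩
    exact map_X_mem_maxIdeal 𝒜 hX i
  · rw [maxIdeal, HomogeneousIdeal.irrelevant_eq_span, Ideal.span_le]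
    intro r hr
    simp only [Set.mem_iUnion] at hr
    obtain ⟨m, hm, hr⟩ := hr
    refine piece_le_of_monomials 𝒜 hφ hX (fun α hα => ?_) hr
    obtain ⟨i, hi⟩ : ∃ i, α i ≠ 0 := by
      by_contra! h
      simp [h] at hα
      omega
    exact Ideal.mem_of_dvd _ ((dvd_pow_self _ hi).trans
      (Finset.dvd_prod_of_mem (fun i => φ (X i) ^ α i) (Finset.mem_univ i)))
      (Ideal.subset_span ⟨i, rfl⟩)

/-- The degree zero component of a polynomial is a constant, and constants survive in `R` because `k
→ R` is injective when `R ≠ 0`. -/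
theorem comap_maxIdeal [Nontrivial R] (hX : ∀ i, φ (X i) ∈ 𝒜 1) :
    (maxIdeal 𝒜).comap φ = maxIdeal (homogeneousSubmodule (Fin n) k) := by
  ext a
  rw [Ideal.mem_comap]
  change φ a ∈ HomogeneousIdeal.irrelevant 𝒜 ↔
    a ∈ HomogeneousIdeal.irrelevant (homogeneousSubmodule (Fin n) k)
  rw [HomogeneousIdeal.mem_irrelevant_iff, HomogeneousIdeal.mem_irrelevant_iff,
    GradedRing.proj_apply, GradedRing.proj_apply, decompose_map 𝒜 hX]
  constructor
  · intro h
    have h0 := SetLike.coe_mem (decompose (homogeneousSubmodule (Fin n) k) a 0)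
    have h1 := totalDegree_eq_zero_iff_eq_C.1
      (Nat.le_zero.1 (((mem_homogeneousSubmodule 0 _).1 h0).totalDegree_le))
    rw [h1, ← MvPolynomial.algebraMap_eq, AlgHom.commutes,
      map_eq_zero_iff _ (algebraMap k R).injective] at h
    rw [h1, h, map_zero]
  · intro h
    rw [h, map_zero]

end GradedMap

/-! ### Bounds for the top socle degree. -/

section TopSocleDegree

variable {k : Type v} [Field k] {R : Type u} [CommRing R] [Algebra k R] (𝒜 : ℕ → Submodule k R)

theorem map_mkₐ_ne_bot_iff (𝔞 : Ideal R) (m : ℕ) :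
    (𝒜 m).map (Ideal.Quotient.mkₐ k 𝔞).toLinearMap ≠ ⊥ ↔ ¬ ∀ r ∈ 𝒜 m, r ∈ 𝔞 := by
  rw [Ne, not_iff_not, Submodule.eq_bot_iff]
  simp [Ideal.Quotient.eq_zero_iff_mem]

theorem topSocleDegree_le {𝔞 : Ideal R} {b : ℕ} (h : ∀ m > b, ∀ r ∈ 𝒜 m, r ∈ 𝔞) :
    topSocleDegree 𝒜 𝔞 ≤ b := by
  refine csSup_le' fun m hm => ?_
  by_contra! hb
  exact (map_mkₐ_ne_bot_iff 𝒜 𝔞 m).1 hm (h m hb)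

/-- The bound `N` is essential: the supremum of an unbounded set of naturals is `0` by convention.
-/
theorem le_topSocleDegree {𝔞 : Ideal R} {N m : ℕ} (h : ∀ m ≥ N, ∀ r ∈ 𝒜 m, r ∈ 𝔞) {r : R}
    (hr : r ∈ 𝒜 m) (hr' : r ∉ 𝔞) : m ≤ topSocleDegree 𝒜 𝔞 := by
  refine le_csSup ⟨N, fun m hm => ?_⟩ ((map_mkₐ_ne_bot_iff 𝒜 𝔞 m).2 fun h => hr' (h r hr))
  by_contra! hb
  exact (map_mkₐ_ne_bot_iff 𝒜 𝔞 m).1 hm (h m hb.le)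

theorem mem_of_topSocleDegree_lt {𝔞 : Ideal R} {N m : ℕ} (h : ∀ m ≥ N, ∀ r ∈ 𝒜 m, r ∈ 𝔞)
    (hm : topSocleDegree 𝒜 𝔞 < m) {r : R} (hr : r ∈ 𝒜 m) : r ∈ 𝔞 := by
  by_contra hr'
  exact absurd (le_topSocleDegree 𝒜 h hr hr') (not_le.2 hm)

end TopSocleDegree

/-! ### Frobenius powers of ideals. -/

section FrobeniusPower

theorem frobeniusPower_eq_map {R : Type u} [CommRing R] (p : ℕ) [ExpChar R p] (I : Ideal R)
    (e : ℕ) : frobeniusPower I (p ^ e) = I.map (iterateFrobenius R p e) := by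
  rw [frobeniusPower, Ideal.map]
  congr 1

theorem pow_mem_frobeniusPower {R : Type u} [CommRing R] {I : Ideal R} {r : R} (hr : r ∈ I)
    (q : ℕ) : r ^ q ∈ frobeniusPower I q :=
  Ideal.subset_span ⟨r, hr, rfl⟩

theorem pow_mem_frobeniusPower_succ {R : Type u} [CommRing R] (p : ℕ) [ExpChar R p] {I : Ideal R}
    {e : ℕ} {r : R} (hr : r ∈ frobeniusPower I (p ^ e)) :
    r ^ p ∈ frobeniusPower I (p ^ (e + 1)) := by
  have h : (frobeniusPower I (p ^ e)).map (frobenius R p) ≤ frobeniusPower I (p ^ (e + 1)) := by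
    rw [frobeniusPower, Ideal.map_span, Ideal.span_le]
    rintro _ ⟨_, ⟨s, hs, rfl⟩, rfl⟩
    refine Ideal.subset_span ⟨s, hs, ?_⟩
    simp only [frobenius_def]
    rw [← pow_mul, pow_succ]
  exact h (Ideal.mem_map_of_mem _ hr)

theorem map_frobeniusPower {A B : Type*} [CommRing A] [CommRing B] (φ : A →+* B)
    (hφ : Function.Surjective φ) (I : Ideal B) (q : ℕ) :
    (frobeniusPower (I.comap φ) q).map φ = frobeniusPower I q := by
  rw [frobeniusPower, frobeniusPower, Ideal.map_span]
  congr 1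
  ext b
  constructor
  · rintro ⟨_, ⟨a, ha, rfl⟩, rfl⟩
    exact ⟨φ a, ha, by simp⟩
  · rintro ⟨b, hb, rfl⟩
    obtain ⟨a, rfl⟩ := hφ b
    exact ⟨_, ⟨a, hb, rfl⟩, by simp⟩

theorem isHomogeneous_frobeniusPower {k : Type v} [Field k] {R : Type u} [CommRing R] [Algebra k R]
    (p : ℕ) [ExpChar R p] (𝒜 : ℕ → Submodule k R) [GradedAlgebra 𝒜] {I : Ideal R}
    (hI : I.IsHomogeneous 𝒜) (e : ℕ) : (frobeniusPower I (p ^ e)).IsHomogeneous 𝒜 := by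
  obtain ⟨s, rfl⟩ := (Ideal.IsHomogeneous.iff_exists 𝒜 I).1 hI
  rw [frobeniusPower_eq_map, Ideal.map_span]
  refine Ideal.homogeneous_span 𝒜 _ ?_
  rintro _ ⟨_, ⟨⟨r, m, hr⟩, _, rfl⟩, rfl⟩
  exact ⟨p ^ e • m, by rw [iterateFrobenius_def]; exact SetLike.pow_mem_graded _ hr⟩

end FrobeniusPower

/-- If `a (e + 1) ≤ p * a e + C` for all `e`, then `a e / p ^ e` converges. -/
theorem exists_tendsto_div_pow {p : ℕ} (hp : 2 ≤ p) {a : ℕ → ℕ} {C : ℕ}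
    (h : ∀ e, a (e + 1) ≤ p * a e + C) :
    ∃ c : ℝ, Tendsto (fun e => (a e : ℝ) / (p : ℝ) ^ e) atTop (𝓝 c) := by
  have hp' : (2 : ℝ) ≤ p := by exact_mod_cast hp
  have hp0 : (0 : ℝ) < p := by linarith
  -- The shift by `C` makes the sequence monotone: since `p ≥ 2`, `p a + 2C ≤ p (a + C)`.
  have hanti : Antitone fun e => ((a e : ℝ) + C) / (p : ℝ) ^ e := by
    refine antitone_nat_of_succ_le fun e => ?_
    rw [div_le_div_iff₀ (by positivity) (by positivity), pow_succ]
    have h1 : (a (e + 1) : ℝ) ≤ p * a e + C := by exact_mod_cast h e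
    have h2 : (C : ℝ) + C ≤ C * p := by nlinarith [Nat.cast_nonneg (α := ℝ) C]
    have h3 : (a (e + 1) : ℝ) + C ≤ ((a e : ℝ) + C) * p := by linarith
    calc ((a (e + 1) : ℝ) + C) * (p : ℝ) ^ e ≤ (((a e : ℝ) + C) * p) * (p : ℝ) ^ e := by gcongr
      _ = _ := by ring
  have hlim := tendsto_atTop_ciInf hanti ⟨0, by rintro _ ⟨e, rfl⟩; positivity⟩
  have hC : Tendsto (fun e : ℕ => (C : ℝ) / (p : ℝ) ^ e) atTop (𝓝 0) :=
    tendsto_const_nhds.div_atTop (tendsto_pow_atTop_atTop_of_one_lt (by linarith))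
  refine ⟨_, (hlim.sub hC).congr fun e => ?_⟩
  ring

/-! ### Existence of the diagonal `F`-threshold. -/

section Existence

variable {k : Type v} [Field k] (p : ℕ) [hp : Fact p.Prime]
  {R : Type u} [CommRing R] [Algebra k R]
  (𝒜 : ℕ → Submodule k R) [GradedAlgebra 𝒜] {n : ℕ} {φ : MvPolynomial (Fin n) k →ₐ[k] R}

open MvPolynomial

theorem exists_piece_le_frobeniusPower (hφ : Function.Surjective φ) (hX : ∀ i, φ (X i) ∈ 𝒜 1)
    {I : Ideal R} (hIm : I.radical = maxIdeal 𝒜) (q : ℕ) :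
    ∃ N, ∀ m ≥ N, ∀ r ∈ 𝒜 m, r ∈ frobeniusPower I q := by
  have h : ∀ i, ∃ a, φ (X i) ^ a ∈ I := fun i => by
    have := map_X_mem_maxIdeal 𝒜 hX i
    rwa [← hIm] at this
  choose a ha using h
  -- Pigeonhole: in a monomial of this degree some exponent is at least `a i * q`, and `(x_i ^ a_i)
  -- ^ q` lies in the Frobenius power.
  refine ⟨∑ i, (a i * q) + 1, fun m hm r hr => piece_le_of_monomials 𝒜 hφ hX (fun α hα => ?_) hr⟩
  obtain ⟨i, hi⟩ : ∃ i, a i * q ≤ α i := by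
    by_contra! h
    have := Finset.sum_le_sum fun i (_ : i ∈ Finset.univ) => (h i).le
    omega
  refine Ideal.mem_of_dvd _ ((pow_dvd_pow _ hi).trans
    (Finset.dvd_prod_of_mem (fun i => φ (X i) ^ α i) (Finset.mem_univ i))) ?_
  rw [pow_mul]
  exact pow_mem_frobeniusPower (ha i) q

/-- Rounding an exponent down to a multiple of `p` loses less than `p`, hence at most `n * p` over
all variables. The rounded monomial is a `p`-th power, and Frobenius carries membership from level
`e` to level `e + 1`. -/
theorem topSocleDegree_frobeniusPower_succ_le [ExpChar R p] (hφ : Function.Surjective φ)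
    (hX : ∀ i, φ (X i) ∈ 𝒜 1) {I : Ideal R} (hIm : I.radical = maxIdeal 𝒜) (e : ℕ) :
    topSocleDegree 𝒜 (frobeniusPower I (p ^ (e + 1))) ≤
      p * topSocleDegree 𝒜 (frobeniusPower I (p ^ e)) + n * p := by
  obtain ⟨N, hN⟩ := exists_piece_le_frobeniusPower 𝒜 hφ hX hIm (p ^ e)
  refine topSocleDegree_le 𝒜 fun m hm r hr => piece_le_of_monomials 𝒜 hφ hX (fun α hα => ?_) hr
  have hlt : topSocleDegree 𝒜 (frobeniusPower I (p ^ e)) < ∑ i, α i / p := by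
    have h1 : ∑ i, α i ≤ p * ∑ i, α i / p + n * p := by
      calc ∑ i, α i ≤ ∑ i : Fin n, (p * (α i / p) + p) := Finset.sum_le_sum fun i _ => by
            have := Nat.div_add_mod (α i) p
            have := Nat.mod_lt (α i) hp.out.pos
            omega
        _ = _ := by simp [Finset.sum_add_distrib, Finset.mul_sum]
    have h2 : p * topSocleDegree 𝒜 (frobeniusPower I (p ^ e)) < p * ∑ i, α i / p := by omega
    exact lt_of_mul_lt_mul_left h2 (Nat.zero_le p)
  have h3 := pow_mem_frobeniusPower_succ p
    (mem_of_topSocleDegree_lt 𝒜 hN hlt (prod_pow_mem 𝒜 hX fun i => α i / p))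
  refine Ideal.mem_of_dvd _ ?_ h3
  rw [← Finset.prod_pow]
  refine Finset.prod_dvd_prod_of_dvd _ _ fun i _ => ?_
  rw [← pow_mul]
  exact pow_dvd_pow _ (Nat.div_mul_le_self _ _)

theorem exists_hasDiagonalFThreshold [ExpChar R p] (hφ : Function.Surjective φ)
    (hX : ∀ i, φ (X i) ∈ 𝒜 1) {I : Ideal R} (hIm : I.radical = maxIdeal 𝒜) :
    ∃ c : ℝ, HasDiagonalFThreshold p 𝒜 I c :=
  exists_tendsto_div_pow hp.out.two_le
    (topSocleDegree_frobeniusPower_succ_le p 𝒜 hφ hX hIm)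

end Existence

theorem exists_presentation {k : Type v} [Field k] {R : Type u} [CommRing R] [Algebra k R]
    (𝒜 : ℕ → Submodule k R) (hfin : Module.Finite k (𝒜 1))
    (hadj : Algebra.adjoin k (𝒜 1 : Set R) = ⊤) :
    ∃ (n : ℕ) (φ : MvPolynomial (Fin n) k →ₐ[k] R), Function.Surjective φ ∧
      ∀ i, φ (MvPolynomial.X i) ∈ 𝒜 1 := by
  obtain ⟨n, s, hs⟩ := Module.Finite.exists_fin (R := k) (M := 𝒜 1)
  refine ⟨n, MvPolynomial.aeval fun i => (s i : R), ?_, fun i => by simp⟩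
  rw [← AlgHom.range_eq_top, ← Algebra.adjoin_range_eq_range_aeval, eq_top_iff, ← hadj]
  refine Algebra.adjoin_le fun r hr => ?_
  have h1 : r ∈ (Submodule.span k (Set.range s)).map (𝒜 1).subtype := by
    rw [hs]
    exact ⟨⟨r, hr⟩, trivial, rfl⟩
  rw [Submodule.map_span, ← Set.range_comp] at h1
  exact Algebra.span_le_adjoin k _ h1

/-! ### Thresholds of `S` and of `S/(f_1, …, f_t)`. -/

section Comparison

variable {k : Type v} [Field k] {n t : ℕ}

open MvPolynomial DirectSum

local notation "𝒮" => homogeneousSubmodule (Fin n) k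

/-- If all forms of degree `> T` lie in `B + (f_1, …, f_t)`, then all forms of degree
`> T + q ∑ deg f_i` lie in `B`, provided `f_i ^ q ∈ B`. -/
theorem piece_le_of_piece_le_sup {B : Ideal (MvPolynomial (Fin n) k)} (hB : B.IsHomogeneous 𝒮)
    {f : Fin t → MvPolynomial (Fin n) k} {d : Fin t → ℕ} (hf : ∀ i, f i ∈ 𝒮 (d i)) {q T : ℕ}
    (hfq : ∀ i, f i ^ q ∈ B)
    (h : ∀ m > T, ∀ a ∈ 𝒮 m, a ∈ B ⊔ Ideal.span (Set.range f)) {m : ℕ}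
    (hm : T + q * ∑ i, d i < m) {a : MvPolynomial (Fin n) k} (ha : a ∈ 𝒮 m) : a ∈ B := by
  -- `α` records the powers of the `f_i` extracted so far and `b` is the remaining cofactor, so the
  -- total degree is constant. `M` bounds the number of extractions still needed before some
  -- exponent must reach `q`.
  have key : ∀ (M : ℕ) (α : Fin t → ℕ) (j : ℕ) (b : MvPolynomial (Fin n) k), b ∈ 𝒮 j →
      T + q * ∑ i, d i < j + ∑ i, α i * d i → t * q ≤ M + ∑ i, α i →
      (∏ i, f i ^ α i) * b ∈ B := by
    intro M
    induction M with
    | zero =>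
      intro α j b hb hj hM
      by_cases hα : ∃ i, q ≤ α i
      · obtain ⟨i, hi⟩ := hα
        exact Ideal.mul_mem_right _ _ (Ideal.mem_of_dvd _ ((pow_dvd_pow _ hi).trans
          (Finset.dvd_prod_of_mem (fun i => f i ^ α i) (Finset.mem_univ i))) (hfq i))
      · push Not at hα
        have h1 : ∑ i, α i * d i ≤ q * ∑ i, d i := by
          rw [Finset.mul_sum]
          exact Finset.sum_le_sum fun i _ => Nat.mul_le_mul_right _ (hα i).le
        -- With all `α i < q` and `t ≠ 0`, the sum of the `α i` is strictly less than `t * q`; so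
        -- only the empty sequence is left.
        have ht : IsEmpty (Fin t) := by
          by_contra hne
          rw [not_isEmpty_iff] at hne
          have := Finset.sum_lt_sum_of_nonempty (s := (Finset.univ : Finset (Fin t)))
            Finset.univ_nonempty fun i _ => hα i
          simp at this
          omega
        have h2 := h j (by omega) b hb
        rw [Set.range_eq_empty, Ideal.span_empty, sup_bot_eq] at h2
        exact Ideal.mul_mem_left _ _ h2
    | succ M ih =>
      intro α j b hb hj hM
      by_cases hα : ∃ i, q ≤ α i
      · obtain ⟨i, hi⟩ := hα
        exact Ideal.mul_mem_right _ _ (Ideal.mem_of_dvd _ ((pow_dvd_pow _ hi).trans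
          (Finset.dvd_prod_of_mem (fun i => f i ^ α i) (Finset.mem_univ i))) (hfq i))
      push Not at hα
      have h1 : ∑ i, α i * d i ≤ q * ∑ i, d i := by
        rw [Finset.mul_sum]
        exact Finset.sum_le_sum fun i _ => Nat.mul_le_mul_right _ (hα i).le
      -- As long as every `α i < q`, the extracted powers account for at most `q ∑ d i`, so `b`
      -- still has degree above `T` and can be rewritten.
      obtain ⟨c, hc, g, hg, hcg⟩ := Submodule.mem_sup.1 (h j (by omega) b hb)
      obtain ⟨w, rfl⟩ := (Ideal.mem_span_range_iff_exists_fun).1 hg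
      have hb' : b = (decompose 𝒮 c j : MvPolynomial (Fin n) k) +
          ∑ i, (decompose 𝒮 (f i * w i) j : MvPolynomial (Fin n) k) := by
        conv_lhs => rw [← decompose_of_mem_same 𝒮 hb, ← hcg]
        simp [decompose_add, decompose_sum, mul_comm]
      rw [hb', mul_add, Finset.mul_sum]
      refine Ideal.add_mem _ (Ideal.mul_mem_left _ _ (hB j hc)) (Ideal.sum_mem _ fun i _ => ?_)
      by_cases hij : d i ≤ j
      · rw [coe_decompose_mul_of_left_mem_of_le 𝒮 (hf i) hij, ← mul_assoc]
        -- One more factor `f i` is moved out of the cofactor.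
        have h3 := ih (α + Pi.single i 1) (j - d i) _
          (SetLike.coe_mem (decompose 𝒮 (w i) (j - d i))) ?_ ?_
        · have h4 : ∏ l, f l ^ (α + Pi.single i 1 : Fin t → ℕ) l = (∏ l, f l ^ α l) * f i := by
            simp_rw [Pi.add_apply, pow_add, Finset.prod_mul_distrib]
            congr 1
            rw [Finset.prod_eq_single i (fun l _ hl => by simp [hl]) (by simp), Pi.single_eq_same,
              pow_one]
          rwa [h4] at h3
        · have h4 : ∑ l, (α + Pi.single i 1 : Fin t → ℕ) l * d l = (∑ l, α l * d l) + d i := by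
            simp_rw [Pi.add_apply, add_mul, Finset.sum_add_distrib]
            congr 1
            rw [Finset.sum_eq_single i (fun l _ hl => by simp [hl]) (by simp), Pi.single_eq_same,
              one_mul]
          omega
        · simp_rw [Pi.add_apply, Finset.sum_add_distrib, Finset.sum_pi_single',
            Finset.mem_univ, if_true]
          omega
      · rw [coe_decompose_mul_of_left_mem_of_not_le 𝒮 (hf i) hij, mul_zero]
        exact B.zero_mem
  simpa using key (t * q) 0 m a ha (by simpa using hm) (by simp)

variable (p : ℕ) [hp : Fact p.Prime] {R : Type u} [CommRing R] [Algebra k R]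
  (𝒜 : ℕ → Submodule k R) [GradedAlgebra 𝒜] {φ : MvPolynomial (Fin n) k →ₐ[k] R}

theorem radical_comap [Nontrivial R] (hX : ∀ i, φ (X i) ∈ 𝒜 1) {I : Ideal R}
    (hIm : I.radical = maxIdeal 𝒜) :
    (I.comap φ).radical = maxIdeal (homogeneousSubmodule (Fin n) k) := by
  rw [← comap_maxIdeal 𝒜 hX, ← hIm, Ideal.comap_radical]

theorem exists_hasDiagonalFThreshold_mvPolynomial [ExpChar k p]
    {J : Ideal (MvPolynomial (Fin n) k)} (hJ : J.radical = maxIdeal 𝒮) :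
    ∃ c : ℝ, HasDiagonalFThreshold p 𝒮 J c :=
  exists_hasDiagonalFThreshold p 𝒮 (φ := AlgHom.id k _) Function.surjective_id
    (fun i => (mem_homogeneousSubmodule 1 _).2 (isHomogeneous_X k i)) hJ

/-- Apply `piece_le_of_piece_le_sup` with `B = J^{[q]}`, where `J` is the preimage of `I`. Since
`f_i ∈ ker φ ⊆ J`, each `f_i ^ q` lies in `B`, and the preimage of `I^{[q]}` is `B + ker φ`. Divide
by `q` and pass to the limit. -/
theorem threshold_ge_sub_sum_degrees [ExpChar k p] [Nontrivial R] (hφ : Function.Surjective φ)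
    (hX : ∀ i, φ (X i) ∈ 𝒜 1) {f : Fin t → MvPolynomial (Fin n) k} {d : Fin t → ℕ}
    (hf : ∀ i, (f i).IsHomogeneous (d i)) (hker : RingHom.ker φ = Ideal.span (Set.range f))
    {I : Ideal R} (hI : I.IsHomogeneous 𝒜) (hIm : I.radical = maxIdeal 𝒜) {cR cS : ℝ}
    (hR : HasDiagonalFThreshold p 𝒜 I cR) (hS : HasDiagonalFThreshold p 𝒮 (I.comap φ) cS) :
    cR ≥ cS - ∑ i, (d i : ℝ) := by
  have hp0 : (0 : ℝ) < p := by exact_mod_cast hp.out.pos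
  have hle : ∀ e, topSocleDegree 𝒮 (frobeniusPower (I.comap φ) (p ^ e)) ≤
      topSocleDegree 𝒜 (frobeniusPower I (p ^ e)) + p ^ e * ∑ i, d i := by
    intro e
    obtain ⟨N, hN⟩ := exists_piece_le_frobeniusPower 𝒜 hφ hX hIm (p ^ e)
    refine topSocleDegree_le _ fun m hm a ha => ?_
    refine piece_le_of_piece_le_sup (isHomogeneous_frobeniusPower p 𝒮
      (isHomogeneous_comap 𝒜 hX hI) e) (fun i => (mem_homogeneousSubmodule _ _).2 (hf i))
      (fun i => pow_mem_frobeniusPower ?_ _) (fun m hm a ha => ?_) hm ha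
    · rw [Ideal.mem_comap, show φ (f i) = 0 from ?_]
      · exact I.zero_mem
      · rw [← RingHom.mem_ker, hker]
        exact Ideal.subset_span ⟨i, rfl⟩
    · have h1 := mem_of_topSocleDegree_lt 𝒜 hN hm (map_mem_piece 𝒜 hX ha)
      have h2 : (frobeniusPower (I.comap φ) (p ^ e)).map φ = frobeniusPower I (p ^ e) :=
        map_frobeniusPower φ.toRingHom hφ I _
      rw [← h2, ← Ideal.mem_comap, Ideal.comap_map_of_surjective' φ hφ] at h1
      rwa [← hker]
  refine sub_le_iff_le_add.2 (le_of_tendsto_of_tendsto' hS (hR.add_const _) fun e => ?_)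
  have h1 : (topSocleDegree 𝒮 (frobeniusPower (I.comap φ) (p ^ e)) : ℝ) ≤
      topSocleDegree 𝒜 (frobeniusPower I (p ^ e)) + (p : ℝ) ^ e * ∑ i, (d i : ℝ) := by
    exact_mod_cast hle e
  have h2 : (0 : ℝ) < (p : ℝ) ^ e := by positivity
  have h3 : (topSocleDegree 𝒮 (frobeniusPower (I.comap φ) (p ^ e)) : ℝ) / (p : ℝ) ^ e ≤
      topSocleDegree 𝒜 (frobeniusPower I (p ^ e)) / (p : ℝ) ^ e + ∑ i, (d i : ℝ) := by
    rw [div_add' _ _ _ h2.ne', div_le_div_iff_of_pos_right h2]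
    linarith
  exact h3

theorem maxIdeal_mvPolynomial : maxIdeal 𝒮 = RingHom.ker (constantCoeff (σ := Fin n) (R := k)) := by
  ext a
  change a ∈ HomogeneousIdeal.irrelevant 𝒮 ↔ _
  rw [HomogeneousIdeal.mem_irrelevant_iff, GradedRing.proj_apply, RingHom.mem_ker]
  have h : (decompose 𝒮 a 0 : MvPolynomial (Fin n) k) = homogeneousComponent 0 a :=
    decomposition.decompose'_apply a 0
  rw [h, homogeneousComponent_zero, C_eq_zero, constantCoeff_eq]

/-- The diagonal `F`-threshold of a polynomial ring is at least the number of variables. -/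
theorem card_le_threshold_maxIdeal [ExpChar k p] {c : ℝ}
    (hc : HasDiagonalFThreshold p 𝒮 (maxIdeal 𝒮) c) : (n : ℝ) ≤ c := by
  have hp0 : (0 : ℝ) < p := by exact_mod_cast hp.out.pos
  have hX1 : ∀ i, AlgHom.id k (MvPolynomial (Fin n) k) (X i) ∈ 𝒮 1 :=
    fun i => (mem_homogeneousSubmodule 1 _).2 (isHomogeneous_X k i)
  have hspan := span_map_X 𝒮 (φ := AlgHom.id k _) Function.surjective_id hX1
  have hrad : (maxIdeal 𝒮).radical = maxIdeal 𝒮 := by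
    rw [maxIdeal_mvPolynomial]
    exact (RingHom.ker_isPrime _).radical
  -- The witness is `∏ x_i ^ (q - 1)`: no generator `x_i ^ q` of the monomial ideal `𝔪^{[q]}`
  -- divides it.
  have hle : ∀ e, n * (p ^ e - 1) ≤ topSocleDegree 𝒮 (frobeniusPower (maxIdeal 𝒮) (p ^ e)) := by
    intro e
    obtain ⟨N, hN⟩ := exists_piece_le_frobeniusPower 𝒮 (φ := AlgHom.id k _)
      Function.surjective_id hX1 hrad (p ^ e)
    have h1 := prod_pow_mem 𝒮 hX1 fun _ => p ^ e - 1
    simp only [Finset.sum_const, Finset.card_univ, Fintype.card_fin, smul_eq_mul] at h1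
    refine le_topSocleDegree 𝒮 hN h1 ?_
    rw [frobeniusPower_eq_map p, ← hspan, Ideal.map_span, ← Set.range_comp]
    intro h2
    have h3 : (monomial (Finsupp.equivFunOnFinite.symm fun _ => p ^ e - 1) (1 : k) :
        MvPolynomial (Fin n) k) ∈
        Ideal.span ((fun s => monomial s (1 : k)) ''
          Set.range fun i : Fin n => Finsupp.single i (p ^ e)) := by
      have hgen : (⇑(iterateFrobenius (MvPolynomial (Fin n) k) p e) ∘
          fun i => (AlgHom.id k (MvPolynomial (Fin n) k)) (X i)) =
          (fun s => monomial s (1 : k)) ∘ fun i : Fin n => Finsupp.single i (p ^ e) := by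
        ext1 i
        simp [iterateFrobenius_def, X_pow_eq_monomial]
      have hmon : (monomial (Finsupp.equivFunOnFinite.symm fun _ => p ^ e - 1) (1 : k) :
          MvPolynomial (Fin n) k) =
          ∏ i, (AlgHom.id k (MvPolynomial (Fin n) k)) (X i) ^ (p ^ e - 1) := by
        rw [monomial_eq, Finsupp.prod_fintype _ _ (fun i => pow_zero _)]
        simp
      rwa [← Set.range_comp, ← hgen, hmon]
    rw [mem_ideal_span_monomial_image] at h3
    obtain ⟨_, ⟨i, rfl⟩, hi⟩ := h3 (Finsupp.equivFunOnFinite.symm fun _ => p ^ e - 1)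
      (by rw [mem_support_iff, coeff_monomial, if_pos rfl]; exact one_ne_zero)
    have h4 := hi i
    have : 0 < p ^ e := pow_pos hp.out.pos e
    simp at h4
    omega
  have hlim : Tendsto (fun e : ℕ => (n : ℝ) - n / (p : ℝ) ^ e) atTop (𝓝 (n - 0)) :=
    tendsto_const_nhds.sub (tendsto_const_nhds.div_atTop
      (tendsto_pow_atTop_atTop_of_one_lt (by exact_mod_cast hp.out.one_lt)))
  rw [sub_zero] at hlim
  refine le_of_tendsto_of_tendsto' hlim hc fun e => ?_
  have h2 : (0 : ℝ) < (p : ℝ) ^ e := by positivity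
  rw [le_div_iff₀ h2, sub_mul, div_mul_cancel₀ _ h2.ne']
  have h3 : ((n * (p ^ e - 1) : ℕ) : ℝ) ≤
      topSocleDegree 𝒮 (frobeniusPower (maxIdeal 𝒮) (p ^ e)) := by exact_mod_cast hle e
  rw [Nat.cast_mul, Nat.cast_sub (Nat.one_le_pow _ _ hp.out.pos)] at h3
  push_cast at h3
  linarith

end Comparison

/-! ### Signs and the contractible complex of the full simplex. -/

section CechSign

variable {n : ℕ} {A : Type*} [CommRing A]

/-- The sign `(-1) ^ #{l ∈ s | l < i}` of the Čech differential. -/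
def cechSign (A : Type*) [CommRing A] (s : Finset (Fin n)) (i : Fin n) : A :=
  (-1) ^ (s.filter (· < i)).card

theorem cechSign_mul_self (s : Finset (Fin n)) (i : Fin n) :
    cechSign A s i * cechSign A s i = 1 := by
  rw [cechSign, ← mul_pow]
  simp

/-- Removing the smaller index drops one element from the count below `i`; removing the larger one
does not affect the count below `l`. -/
theorem cechSign_erase_of_lt {s : Finset (Fin n)} {i l : Fin n} (h : l < i) (hl : l ∈ s) :
    cechSign A (s.erase l) i = -cechSign A s i ∧ cechSign A (s.erase i) l = cechSign A s l := by
  constructor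
  · have h1 : (s.erase l).filter (· < i) = (s.filter (· < i)).erase l := by
      ext x
      simp only [Finset.mem_filter, Finset.mem_erase]
      tauto
    have h2 : l ∈ s.filter (· < i) := Finset.mem_filter.2 ⟨hl, h⟩
    rw [cechSign, cechSign, h1, ← Finset.card_erase_add_one h2, pow_succ]
    ring
  · rw [cechSign, cechSign]
    congr 2
    ext x
    simp only [Finset.mem_filter, Finset.mem_erase]
    exact ⟨fun h => ⟨h.1.2, h.2⟩, fun hx => ⟨⟨(hx.2.trans h).ne, hx.1⟩, hx.2⟩⟩

theorem cechSign_mul_cechSign_erase {s : Finset (Fin n)} {i l : Fin n} (hil : i ≠ l) (hi : i ∈ s)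
    (hl : l ∈ s) : cechSign A s i * cechSign A (s.erase i) l =
      -(cechSign A s l * cechSign A (s.erase l) i) := by
  rcases hil.lt_or_gt with h | h
  · rw [(cechSign_erase_of_lt h hi).1, (cechSign_erase_of_lt h hi).2]
    ring
  · rw [(cechSign_erase_of_lt h hl).1, (cechSign_erase_of_lt h hl).2]
    ring

/-- The Čech differential on families indexed by all finite subsets, with constant coefficients. -/
def simplexD (A : Type*) [CommRing A] (n : ℕ) :
    (Finset (Fin n) → A) →+ (Finset (Fin n) → A) where
  toFun c s := ∑ i ∈ s, cechSign A s i * c (s.erase i)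
  map_zero' := by
    funext s
    simp
  map_add' c c' := by
    funext s
    simp [mul_add, Finset.sum_add_distrib]

theorem simplexD_apply (c : Finset (Fin n) → A) (s : Finset (Fin n)) :
    simplexD A n c s = ∑ i ∈ s, cechSign A s i * c (s.erase i) := rfl

theorem simplexD_mul (f : A) (c : Finset (Fin n) → A) :
    simplexD A n (fun s => f * c s) = fun s => f * simplexD A n c s := by
  funext s
  simp only [simplexD_apply, Finset.mul_sum]
  exact Finset.sum_congr rfl fun i _ => by ring

theorem simplexD_simplexD (c : Finset (Fin n) → A) : simplexD A n (simplexD A n c) = 0 := by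
  funext s
  simp only [simplexD_apply, Finset.mul_sum, Pi.zero_apply]
  rw [Finset.sum_sigma']
  -- The terms deleting `i, l` and `l, i` cancel, since their signs are opposite.
  refine Finset.sum_involution (fun x _ => ⟨x.2, x.1⟩) ?_ ?_ ?_ ?_
  · rintro ⟨i, l⟩ h
    simp only [Finset.mem_sigma, Finset.mem_erase] at h
    have h1 := cechSign_mul_cechSign_erase (A := A) (Ne.symm h.2.1) h.1 h.2.2
    simp only [← mul_assoc]
    rw [h1, Finset.erase_right_comm]
    ring
  · rintro ⟨i, l⟩ h _ heq
    simp only [Finset.mem_sigma, Finset.mem_erase] at h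
    simp only [Sigma.mk.injEq] at heq
    exact h.2.1 heq.1
  · rintro ⟨i, l⟩ h
    simp only [Finset.mem_sigma, Finset.mem_erase] at h ⊢
    exact ⟨h.2.2, Ne.symm h.2.1, h.1⟩
  · rintro ⟨i, l⟩ h
    rfl

/-- The contracting homotopy of the full simplex given by the vertex `i₀`. -/
def simplexHomotopy (i₀ : Fin n) (c : Finset (Fin n) → A) (s : Finset (Fin n)) : A :=
  if i₀ ∈ s then 0 else cechSign A (insert i₀ s) i₀ * c (insert i₀ s)

/-- This is `dh + hd = id` applied to a cocycle. If `i₀ ∈ s`, only the face omitting `i₀`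
contributes; otherwise the cocycle equation at `insert i₀ s` expresses `c s` through the other
faces. The empty face is included, so there is no exceptional lowest degree. -/
theorem simplexD_simplexHomotopy (i₀ : Fin n) {c : Finset (Fin n) → A}
    (hc : simplexD A n c = 0) : simplexD A n (simplexHomotopy i₀ c) = c := by
  funext s
  rw [simplexD_apply]
  by_cases h0 : i₀ ∈ s
  · rw [Finset.sum_eq_single i₀]
    · rw [simplexHomotopy, if_neg (Finset.notMem_erase _ _), Finset.insert_erase h0, ← mul_assoc,
        cechSign_mul_self, one_mul]
    · intro i _ hi
      rw [simplexHomotopy, if_pos (Finset.mem_erase.2 ⟨hi.symm, h0⟩), mul_zero]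
    · exact fun h => absurd h0 h
  · have h1 := congrFun hc (insert i₀ s)
    rw [simplexD_apply, Pi.zero_apply, Finset.sum_insert h0, Finset.erase_insert h0] at h1
    have h2 : c s = -(cechSign A (insert i₀ s) i₀ *
        ∑ i ∈ s, cechSign A (insert i₀ s) i * c ((insert i₀ s).erase i)) := by
      linear_combination (cechSign A (insert i₀ s) i₀) * h1 -
        c s * cechSign_mul_self (A := A) (insert i₀ s) i₀
    rw [h2, Finset.mul_sum, ← Finset.sum_neg_distrib]
    refine Finset.sum_congr rfl fun i hi => ?_
    have hne : i ≠ i₀ := fun h => h0 (h ▸ hi)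
    have h3 : (insert i₀ s).erase i = insert i₀ (s.erase i) :=
      Finset.erase_insert_of_ne hne.symm
    rw [simplexHomotopy, if_neg fun h => h0 (Finset.mem_of_mem_erase h), ← h3]
    have h4 := cechSign_mul_cechSign_erase (A := A) hne (Finset.mem_insert_of_mem hi)
      (Finset.mem_insert_self i₀ s)
    rw [Finset.erase_insert h0] at h4
    linear_combination -c ((insert i₀ s).erase i) * (cechSign A s i *
      cechSign A ((insert i₀ s).erase i) i₀ * cechSign_mul_self (A := A) (insert i₀ s) i +
      cechSign A (insert i₀ s) i * cechSign A (insert i₀ s) i₀ * cechSign_mul_self (A := A) s i -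
      cechSign A (insert i₀ s) i * cechSign A s i * h4)

end CechSign

/-! ### The Čech complex of `S` inside the Laurent polynomials. -/

section Laurent

open MvPolynomial

variable (k : Type v) [Field k] (n : ℕ)

/-- The ring of Laurent polynomials in `n` variables. -/
abbrev Laurent : Type v := AddMonoidAlgebra k (Fin n → ℤ)

/-- The exponents of a monomial as integers. -/
def intExponent : (Fin n →₀ ℕ) →+ (Fin n → ℤ) where
  toFun β i := β i
  map_zero' := by
    funext i
    simp
  map_add' β γ := by
    funext i
    simp

/-- The inclusion of polynomials into Laurent polynomials. -/
noncomputable def toLaurent : MvPolynomial (Fin n) k →ₐ[k] Laurent k n :=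
  AddMonoidAlgebra.mapDomainAlgHom k k (intExponent n)

variable {k n}

theorem intExponent_injective : Function.Injective (intExponent n) := by
  intro β γ h
  ext i
  have := congrFun h i
  exact Int.ofNat_injective this

theorem toLaurent_injective : Function.Injective (toLaurent k n) :=
  AddMonoidAlgebra.mapDomain_injective intExponent_injective

theorem toLaurent_monomial (β : Fin n →₀ ℕ) (c : k) :
    toLaurent k n (monomial β c) = AddMonoidAlgebra.single (intExponent n β) c :=
  AddMonoidAlgebra.mapDomain_single

theorem exists_of_coeff_toLaurent_ne_zero {a : MvPolynomial (Fin n) k} {α : Fin n → ℤ}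
    (h : (toLaurent k n a).coeff α ≠ 0) : ∃ β, intExponent n β = α ∧ coeff β a ≠ 0 := by
  by_contra! hβ
  apply h
  rw [← support_sum_monomial_coeff a, map_sum, AddMonoidAlgebra.coeff_sum, Finsupp.finsetSum_apply]
  refine Finset.sum_eq_zero fun β hm => ?_
  rw [toLaurent_monomial, AddMonoidAlgebra.coeff_single, Finsupp.single_apply, if_neg]
  intro he
  exact mem_support_iff.1 hm (hβ β he)

/-- The product of the variables `x_i`, `i ∈ s`. -/
noncomputable def varProd (k : Type v) [Field k] {n : ℕ} (s : Finset (Fin n)) :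
    MvPolynomial (Fin n) k :=
  ∏ i ∈ s, X i

theorem varProd_mem (s : Finset (Fin n)) :
    varProd k s ∈ homogeneousSubmodule (Fin n) k s.card := by
  have h := SetLike.prod_mem_graded (homogeneousSubmodule (Fin n) k) (fun _ => 1)
    (fun i => (X i : MvPolynomial (Fin n) k)) (F := s)
    (fun i _ => (mem_homogeneousSubmodule 1 _).2 (isHomogeneous_X k i))
  simpa [varProd] using h

theorem varProd_pow_eq (s : Finset (Fin n)) (N : ℕ) : varProd k s ^ N =
    monomial (Finsupp.equivFunOnFinite.symm fun i => if i ∈ s then N else 0) 1 := by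
  rw [monomial_eq, Finsupp.prod_fintype _ _ (fun i => pow_zero _), varProd, ← Finset.prod_pow]
  simp only [map_one, one_mul, Finsupp.equivFunOnFinite_symm_apply_apply, pow_ite, pow_zero]
  rw [Finset.prod_ite_mem, Finset.univ_inter]

theorem toLaurent_varProd_pow (s : Finset (Fin n)) (N : ℕ) : toLaurent k n (varProd k s ^ N) =
    AddMonoidAlgebra.single (fun i => if i ∈ s then (N : ℤ) else 0) 1 := by
  rw [varProd_pow_eq, toLaurent_monomial]
  congr 1
  funext i
  by_cases hi : i ∈ s <;> simp [intExponent, hi]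

theorem isUnit_toLaurent_varProd (s : Finset (Fin n)) : IsUnit (toLaurent k n (varProd k s)) := by
  have h := toLaurent_varProd_pow (k := k) s 1
  rw [pow_one] at h
  rw [h]
  refine IsUnit.of_mul_eq_one
    (AddMonoidAlgebra.single (-fun i => if i ∈ s then ((1 : ℕ) : ℤ) else 0) 1) ?_
  rw [AddMonoidAlgebra.single_mul_single, add_neg_cancel, one_mul]
  rfl

theorem coeff_mul_toLaurent_varProd_pow (u : Laurent k n) (s : Finset (Fin n)) (N : ℕ)
    (α : Fin n → ℤ) : (u * toLaurent k n (varProd k s ^ N)).coeff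
      (α + fun i => if i ∈ s then (N : ℤ) else 0) = u.coeff α := by
  rw [toLaurent_varProd_pow, AddMonoidAlgebra.coeff_mul_single_apply, mul_one, add_neg_cancel_right]

/-- The degree `j` part of `I S_{x_s}`, inside the ring of Laurent polynomials. -/
noncomputable def laurentPiece (I : Ideal (MvPolynomial (Fin n) k)) (s : Finset (Fin n)) (j : ℤ) :
    AddSubgroup (Laurent k n) where
  carrier := {u | ∃ N : ℕ, ∃ a ∈ I, a ∈ intPiece (homogeneousSubmodule (Fin n) k) (j + N * s.card) ∧
    u * toLaurent k n (varProd k s ^ N) = toLaurent k n a}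
  zero_mem' := ⟨0, 0, I.zero_mem, Submodule.zero_mem _, by simp⟩
  neg_mem' := by
    rintro u ⟨N, a, haI, ha, hu⟩
    exact ⟨N, -a, I.neg_mem haI, Submodule.neg_mem _ ha, by rw [neg_mul, hu, map_neg]⟩
  add_mem' := by
    rintro u w ⟨N, a, haI, ha, hu⟩ ⟨M, b, hbI, hb, hw⟩
    refine ⟨N + M, a * varProd k s ^ M + b * varProd k s ^ N,
      I.add_mem (I.mul_mem_right _ haI) (I.mul_mem_right _ hbI), Submodule.add_mem _ ?_ ?_, ?_⟩
    · have h := intPiece_mul _ ha (SetLike.pow_mem_graded M (varProd_mem s))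
      convert h using 2
      push_cast [smul_eq_mul]
      ring
    · have h := intPiece_mul _ hb (SetLike.pow_mem_graded N (varProd_mem s))
      convert h using 2
      push_cast [smul_eq_mul]
      ring
    · rw [map_add, map_mul, map_mul, ← hu, ← hw, pow_add, map_mul]
      ring

theorem laurentPiece_mono_ideal {I J : Ideal (MvPolynomial (Fin n) k)} (h : I ≤ J)
    (s : Finset (Fin n)) (j : ℤ) : laurentPiece I s j ≤ laurentPiece J s j := by
  rintro u ⟨N, a, haI, ha⟩
  exact ⟨N, a, h haI, ha⟩

theorem laurentPiece_mono {I : Ideal (MvPolynomial (Fin n) k)} {s s' : Finset (Fin n)}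
    (h : s ⊆ s') (j : ℤ) : laurentPiece I s j ≤ laurentPiece I s' j := by
  rintro u ⟨N, a, haI, ha, hu⟩
  have hprod : varProd k s' = varProd k (s' \ s) * varProd k s :=
    (Finset.prod_sdiff h).symm
  refine ⟨N, a * varProd k (s' \ s) ^ N, I.mul_mem_right _ haI, ?_, ?_⟩
  · have h1 := intPiece_mul _ ha (SetLike.pow_mem_graded N (varProd_mem (k := k) (s' \ s)))
    convert h1 using 2
    rw [← Finset.card_sdiff_add_card_eq_card h]
    push_cast [smul_eq_mul]
    ring
  · rw [hprod, map_mul (toLaurent k n) a, ← hu, mul_pow, map_mul]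
    ring

theorem laurentPiece_bot (s : Finset (Fin n)) (j : ℤ) :
    laurentPiece (⊥ : Ideal (MvPolynomial (Fin n) k)) s j = ⊥ := by
  rw [eq_bot_iff]
  rintro u ⟨N, a, haI, ha, hu⟩
  rw [Ideal.mem_bot.1 haI, map_zero, map_pow] at hu
  exact ((isUnit_toLaurent_varProd s).pow N).mul_left_eq_zero.1 hu

/-- Exponents of the monomials in the degree `j` part of `S_{x_s}`. -/
theorem exponent_of_mem_laurentPiece {I : Ideal (MvPolynomial (Fin n) k)} {s : Finset (Fin n)}
    {j : ℤ} {u : Laurent k n} (hu : u ∈ laurentPiece I s j) {α : Fin n → ℤ} (hα : u.coeff α ≠ 0) :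
    (∀ i ∉ s, 0 ≤ α i) ∧ ∑ i, α i = j := by
  obtain ⟨N, a, -, ha, hu⟩ := hu
  rw [← coeff_mul_toLaurent_varProd_pow u s N α, hu] at hα
  obtain ⟨β, hβ, hβa⟩ := exists_of_coeff_toLaurent_ne_zero hα
  have hβ' : ∀ i, (β i : ℤ) = α i + if i ∈ s then (N : ℤ) else 0 := fun i => congrFun hβ i
  constructor
  · intro i hi
    have := hβ' i
    rw [if_neg hi] at this
    omega
  · unfold intPiece at ha
    split_ifs at ha with hj
    · have h1 := (mem_homogeneousSubmodule _ a).1 ha hβa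
      rw [Finsupp.weight_apply, Finsupp.sum_fintype _ _ (by simp)] at h1
      simp only [Pi.one_apply, smul_eq_mul, mul_one] at h1
      have h2 : ∑ i, (β i : ℤ) = j + N * s.card := by
        rw [← Nat.cast_sum, h1]
        omega
      have h3 : ∑ i, (β i : ℤ) = ∑ i, α i + N * s.card := by
        simp_rw [hβ']
        rw [Finset.sum_add_distrib, Finset.sum_ite_mem, Finset.univ_inter, Finset.sum_const,
          nsmul_eq_mul, mul_comm]
      omega
    · rw [Submodule.mem_bot] at ha
      rw [ha] at hβa
      simp at hβa

theorem single_mem_laurentPiece {s : Finset (Fin n)} {j : ℤ} {α : Fin n → ℤ}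
    (h : ∀ i ∉ s, 0 ≤ α i) (hα : ∑ i, α i = j) (c : k) :
    (AddMonoidAlgebra.single α c : Laurent k n) ∈ laurentPiece ⊤ s j := by
  -- This power of `x_s` is large enough to clear every negative exponent at once.
  set N : ℕ := ∑ i, (α i).natAbs with hN
  have hle : ∀ i, -(N : ℤ) ≤ α i := fun i => by
    have := Finset.single_le_sum (f := fun i => (α i).natAbs) (fun i _ => Nat.zero_le _)
      (Finset.mem_univ i)
    simp only [← hN] at this
    omega
  set β : Fin n →₀ ℕ := Finsupp.equivFunOnFinite.symm
    fun i => (α i + if i ∈ s then (N : ℤ) else 0).toNat with hβ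
  have hβ' : ∀ i, (β i : ℤ) = α i + if i ∈ s then (N : ℤ) else 0 := by
    intro i
    simp only [hβ, Finsupp.equivFunOnFinite_symm_apply_apply]
    rw [Int.toNat_of_nonneg]
    by_cases hi : i ∈ s
    · rw [if_pos hi]
      have := hle i
      omega
    · rw [if_neg hi]
      have := h i hi
      omega
  have hsum : ∑ i, (β i : ℤ) = j + N * s.card := by
    simp_rw [hβ']
    rw [Finset.sum_add_distrib, Finset.sum_ite_mem, Finset.univ_inter, Finset.sum_const,
      nsmul_eq_mul, mul_comm, hα]
  refine ⟨N, monomial β c, trivial, ?_, ?_⟩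
  · have h0 : (0 : ℤ) ≤ j + N * s.card := by
      rw [← hsum]
      positivity
    rw [intPiece, if_pos h0, mem_homogeneousSubmodule]
    refine isHomogeneous_monomial c ?_
    rw [Finsupp.degree_eq_sum, ← hsum, ← Nat.cast_sum, Int.toNat_natCast]
  · rw [toLaurent_varProd_pow, AddMonoidAlgebra.single_mul_single, mul_one, toLaurent_monomial]
    congr 1
    funext i
    exact (hβ' i).symm

/-- The degree `j` part of the Čech cohomology of `S / I` in cohomological degree `i` vanishes,
expressed by lifts of cochains to the Laurent polynomials. -/
def CechVanishes (I : Ideal (MvPolynomial (Fin n) k)) (i : ℕ) (j : ℤ) : Prop :=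
  ∀ c : Finset (Fin n) → Laurent k n, (∀ s, c s ∈ laurentPiece ⊤ s j) →
    (∀ s, s.card ≠ i → c s = 0) → (∀ s, simplexD _ n c s ∈ laurentPiece I s j) →
    ∃ b : Finset (Fin n) → Laurent k n, (∀ s, b s ∈ laurentPiece ⊤ s j) ∧
      (∀ s, s.card + 1 ≠ i → b s = 0) ∧ ∀ s, c s - simplexD _ n b s ∈ laurentPiece I s j

theorem coeff_simplexD (c : Finset (Fin n) → Laurent k n) (s : Finset (Fin n)) (α : Fin n → ℤ) :
    (simplexD _ n c s).coeff α = simplexD k n (fun s => (c s).coeff α) s := by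
  rw [simplexD_apply, simplexD_apply, AddMonoidAlgebra.coeff_sum, Finsupp.finsetSum_apply]
  refine Finset.sum_congr rfl fun i _ => ?_
  unfold cechSign
  rcases neg_one_pow_eq_or (Laurent k n) (s.filter (· < i)).card with h | h <;>
  rcases Nat.even_or_odd (s.filter (· < i)).card with h' | h' <;>
  simp [h'.neg_one_pow]

/-- For a fixed exponent `α` the complex has constant coefficients and can be contracted at a vertex
`i₀` with `0 ≤ α i₀`. The contraction stays in the allowed pieces: its value at `s` comes from
`insert i₀ s`, where `α` is nonnegative off `insert i₀ s`, and `α i₀ ≥ 0` extends this to all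
indices off `s`. -/
theorem cechVanishes_bot_of_exponent {i : ℕ} {j : ℤ}
    (h : ∀ s : Finset (Fin n), s.card = i → ∀ α : Fin n → ℤ, (∀ i ∉ s, 0 ≤ α i) →
      ∑ i, α i = j → ∃ i₀, 0 ≤ α i₀) :
    CechVanishes (⊥ : Ideal (MvPolynomial (Fin n) k)) i j := by
  classical
  intro c hc hci hd
  have hd0 : ∀ α, simplexD k n (fun s => (c s).coeff α) = 0 := by
    intro α
    funext s
    have := hd s
    rw [laurentPiece_bot, AddSubgroup.mem_bot] at this
    rw [← coeff_simplexD, this]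
    rfl
  have hex : ∀ α : Fin n → ℤ, ∃ g : Finset (Fin n) → k,
      (simplexD k n g = fun s => (c s).coeff α) ∧
      ∀ s, g s ≠ 0 → ∃ i₀ ∉ s, (c (insert i₀ s)).coeff α ≠ 0 ∧ 0 ≤ α i₀ := by
    intro α
    by_cases hα : ∃ s, (c s).coeff α ≠ 0
    · obtain ⟨s, hs⟩ := hα
      obtain ⟨h1, h2⟩ := exponent_of_mem_laurentPiece (hc s) hs
      have hcard : s.card = i := by
        by_contra hne
        rw [hci s hne] at hs
        exact hs rfl
      obtain ⟨i₀, hi₀⟩ := h s hcard α h1 h2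
      refine ⟨simplexHomotopy i₀ fun s => (c s).coeff α, simplexD_simplexHomotopy i₀ (hd0 α),
        fun s hs => ⟨i₀, ?_⟩⟩
      rw [simplexHomotopy] at hs
      split_ifs at hs with hmem
      · exact absurd rfl hs
      · exact ⟨hmem, right_ne_zero_of_mul hs, hi₀⟩
    · push Not at hα
      refine ⟨0, ?_, fun s hs => absurd rfl hs⟩
      rw [map_zero]
      funext s
      exact (hα s).symm
  choose g hg hg0 using hex
  -- Only finitely many exponents occur in `c`, so the primitives `g α` assemble into genuine
  -- Laurent polynomials.
  set T : Finset (Fin n → ℤ) := Finset.univ.biUnion fun s => (c s).coeff.support with hT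
  have hgT : ∀ α s, g α s ≠ 0 → α ∈ T := by
    intro α s hs
    obtain ⟨i₀, -, h1, -⟩ := hg0 α s hs
    exact Finset.mem_biUnion.2 ⟨_, Finset.mem_univ _, Finsupp.mem_support_iff.2 h1⟩
  set b : Finset (Fin n) → Laurent k n := fun s => ∑ α ∈ T, AddMonoidAlgebra.single α (g α s)
    with hb
  have hbc : ∀ s α, (b s).coeff α = g α s := by
    intro s α
    simp only [hb]
    rw [AddMonoidAlgebra.coeff_sum, Finsupp.finsetSum_apply]
    simp only [AddMonoidAlgebra.coeff_single, Finsupp.single_apply]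
    rw [Finset.sum_ite_eq']
    split_ifs with hm
    · rfl
    · by_contra hne
      exact hm (hgT α s (Ne.symm hne))
  refine ⟨b, fun s => ?_, fun s hs => ?_, fun s => ?_⟩
  · refine AddSubgroup.sum_mem _ fun α _ => ?_
    by_cases hz : g α s = 0
    · rw [hz, AddMonoidAlgebra.single_zero]
      exact AddSubgroup.zero_mem _
    · obtain ⟨i₀, hi₀, h1, h2⟩ := hg0 α s hz
      obtain ⟨h3, h4⟩ := exponent_of_mem_laurentPiece (hc _) h1
      refine single_mem_laurentPiece (fun l hl => ?_) h4 _
      by_cases hli : l = i₀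
      · rwa [hli]
      · exact h3 l fun hm => (Finset.mem_insert.1 hm).elim hli hl
  · refine Finset.sum_eq_zero fun α _ => ?_
    by_cases hz : g α s = 0
    · rw [hz, AddMonoidAlgebra.single_zero]
    · obtain ⟨i₀, hi₀, h1, h2⟩ := hg0 α s hz
      rw [hci _ (by rwa [Finset.card_insert_of_notMem hi₀])] at h1
      exact absurd rfl h1
  · have : c s - simplexD _ n b s = 0 := by
      rw [sub_eq_zero, ← AddMonoidAlgebra.coeff_inj]
      ext α
      rw [coeff_simplexD]
      simp_rw [hbc]
      exact (congrFun (hg α) s).symm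
    rw [this]
    exact AddSubgroup.zero_mem _

theorem cechVanishes_bot_of_lt {i : ℕ} (hi : i < n) (j : ℤ) :
    CechVanishes (⊥ : Ideal (MvPolynomial (Fin n) k)) i j := by
  refine cechVanishes_bot_of_exponent fun s hs α hα _ => ?_
  obtain ⟨i₀, hi₀⟩ : ∃ i₀, i₀ ∉ s := by
    by_contra! h
    rw [Finset.eq_univ_iff_forall.2 h, Finset.card_univ, Fintype.card_fin] at hs
    omega
  exact ⟨i₀, hα i₀ hi₀⟩

/-- If all exponents were negative, their sum would be at most `-n`. -/
theorem cechVanishes_bot_of_gt {j : ℤ} (hj : -(n : ℤ) < j) :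
    CechVanishes (⊥ : Ideal (MvPolynomial (Fin n) k)) n j := by
  refine cechVanishes_bot_of_exponent fun s _ α _ hα => ?_
  by_contra! h
  have h1 : ∑ i, α i ≤ ∑ _i : Fin n, (-1 : ℤ) := Finset.sum_le_sum fun i _ => by
    have := h i
    omega
  simp at h1
  omega

/-- The class of `1/(x_1 ⋯ x_n)` survives: a boundary at the full index set is a sum of elements
each lacking some variable in the denominator, so the monomial with all exponents `-1` has
coefficient zero in it. -/
theorem not_cechVanishes_bot :
    ¬ CechVanishes (⊥ : Ideal (MvPolynomial (Fin n) k)) n (-n) := by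
  intro h
  set u : Laurent k n := AddMonoidAlgebra.single (fun _ => -1) 1 with hu
  have hc : ∀ s, (Pi.single Finset.univ u : Finset (Fin n) → Laurent k n) s ∈
      laurentPiece ⊤ s (-n) := by
    intro s
    by_cases hs : s = Finset.univ
    · subst hs
      rw [Pi.single_eq_same]
      exact single_mem_laurentPiece (by simp) (by simp) 1
    · rw [Pi.single_eq_of_ne hs]
      exact AddSubgroup.zero_mem _
  have hcn : ∀ s : Finset (Fin n), s.card ≠ n →
      (Pi.single Finset.univ u : Finset (Fin n) → Laurent k n) s = 0 := by
    intro s hs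
    rw [Pi.single_eq_of_ne]
    rintro rfl
    simp at hs
  have hd : ∀ s, simplexD _ n (Pi.single Finset.univ u) s ∈
      laurentPiece (⊥ : Ideal (MvPolynomial (Fin n) k)) s (-n) := by
    intro s
    rw [simplexD_apply, Finset.sum_eq_zero]
    · exact AddSubgroup.zero_mem _
    · intro i hi
      rw [Pi.single_eq_of_ne, mul_zero]
      intro he
      exact Finset.notMem_erase i s (he ▸ Finset.mem_univ i)
  obtain ⟨b, hb, -, hcb⟩ := h _ hc hcn hd
  have h1 := hcb Finset.univ
  rw [laurentPiece_bot, AddSubgroup.mem_bot, Pi.single_eq_same, sub_eq_zero] at h1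
  have h2 : u.coeff (fun _ => -1) =
      simplexD k n (fun s => (b s).coeff fun _ => -1) Finset.univ := by
    rw [← coeff_simplexD, ← h1]
  rw [simplexD_apply, Finset.sum_eq_zero, hu, AddMonoidAlgebra.coeff_single,
    Finsupp.single_eq_same] at h2
  · exact one_ne_zero h2
  · intro i _
    rw [mul_eq_zero]
    right
    by_contra hne
    have := (exponent_of_mem_laurentPiece (hb _) hne).1 i (Finset.notMem_erase _ _)
    omega

end Laurent

/-! ### Passing to the quotient by a regular element. -/

section CechStep

open MvPolynomial DirectSum

variable {k : Type v} [Field k] {n : ℕ}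

local notation "𝒮" => homogeneousSubmodule (Fin n) k

theorem simplexD_mem_laurentPiece {I : Ideal (MvPolynomial (Fin n) k)} {j : ℤ}
    {c : Finset (Fin n) → Laurent k n} (hc : ∀ s, c s ∈ laurentPiece I s j) (s : Finset (Fin n)) :
    simplexD _ n c s ∈ laurentPiece I s j := by
  rw [simplexD_apply]
  refine AddSubgroup.sum_mem _ fun i _ => ?_
  have h1 := laurentPiece_mono (Finset.erase_subset i s) j (hc (s.erase i))
  rw [cechSign]
  rcases neg_one_pow_eq_or (Laurent k n) (s.filter (· < i)).card with h | h
  · rwa [h, one_mul]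
  · rw [h, neg_one_mul]
    exact AddSubgroup.neg_mem _ h1

theorem simplexD_eq_zero_of_card_ne {A : Type*} [CommRing A] {i : ℕ} {c : Finset (Fin n) → A}
    (hc : ∀ s, s.card ≠ i → c s = 0) {s : Finset (Fin n)} (hs : s.card ≠ i + 1) :
    simplexD A n c s = 0 := by
  rw [simplexD_apply]
  refine Finset.sum_eq_zero fun l hl => ?_
  rw [hc, mul_zero]
  have := Finset.card_erase_add_one hl
  omega

theorem toLaurent_mul_mem_laurentPiece {I J : Ideal (MvPolynomial (Fin n) k)}
    {f : MvPolynomial (Fin n) k} {d : ℕ} (hf : f ∈ 𝒮 d) (hIJ : ∀ a ∈ I, a * f ∈ J)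
    {s : Finset (Fin n)} {j : ℤ} {v : Laurent k n} (hv : v ∈ laurentPiece I s j) :
    toLaurent k n f * v ∈ laurentPiece J s (j + d) := by
  obtain ⟨N, a, haI, ha, hu⟩ := hv
  refine ⟨N, a * f, hIJ a haI, ?_, ?_⟩
  · have h := intPiece_mul _ ha hf
    convert h using 2
    ring
  · rw [mul_assoc, hu, map_mul, mul_comm]

/-- Regularity of `f` modulo `I` persists after localization: clear denominators and cancel `f` in
`S`. -/
theorem mem_laurentPiece_of_toLaurent_mul {I : Ideal (MvPolynomial (Fin n) k)}
    {f : MvPolynomial (Fin n) k} (hreg : ∀ a, f * a ∈ I → a ∈ I)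
    {s : Finset (Fin n)} {j j' : ℤ} {v : Laurent k n} (hv : v ∈ laurentPiece ⊤ s j)
    (hfv : toLaurent k n f * v ∈ laurentPiece I s j') : v ∈ laurentPiece I s j := by
  obtain ⟨N, a, -, ha, hav⟩ := hv
  obtain ⟨M, b, hbI, -, hbv⟩ := hfv
  refine ⟨N + M, a * varProd k s ^ M, hreg _ ?_, ?_, ?_⟩
  · have h : f * (a * varProd k s ^ M) = b * varProd k s ^ N := by
      apply toLaurent_injective
      rw [map_mul, map_mul, ← hav, map_mul, ← hbv]
      ring
    rw [h]
    exact I.mul_mem_right _ hbI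
  · have h := intPiece_mul _ ha (SetLike.pow_mem_graded M (varProd_mem s))
    convert h using 2
    push_cast [smul_eq_mul]
    ring
  · rw [pow_add, map_mul, ← mul_assoc, hav, ← map_mul]

/-- Take degree `j` components of any expression `b + f * w`; if `j < d`, the part involving `f` has
none and the cofactor is `0`. -/
theorem exists_homogeneous_decomposition {I : Ideal (MvPolynomial (Fin n) k)}
    (hI : I.IsHomogeneous 𝒮) {f : MvPolynomial (Fin n) k} {d : ℕ} (hf : f ∈ 𝒮 d) {j : ℤ}
    {a : MvPolynomial (Fin n) k} (ha : a ∈ intPiece 𝒮 j) (haI : a ∈ I ⊔ Ideal.span {f}) :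
    ∃ b ∈ I, b ∈ intPiece 𝒮 j ∧ ∃ w ∈ intPiece 𝒮 (j - d), a = b + f * w := by
  by_cases hj : 0 ≤ j
  · have hpc : intPiece 𝒮 j = 𝒮 j.toNat := if_pos hj
    rw [hpc] at ha ⊢
    obtain ⟨b, hb, g, hg, rfl⟩ := Submodule.mem_sup.1 haI
    obtain ⟨w, rfl⟩ := Ideal.mem_span_singleton'.1 hg
    have ha' : b + w * f = (decompose 𝒮 b j.toNat : MvPolynomial (Fin n) k) +
        (decompose 𝒮 (f * w) j.toNat : MvPolynomial (Fin n) k) := by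
      conv_lhs => rw [← decompose_of_mem_same 𝒮 ha]
      simp [decompose_add, mul_comm]
    refine ⟨_, hI _ hb, SetLike.coe_mem _, ?_⟩
    by_cases hd : d ≤ j.toNat
    · rw [coe_decompose_mul_of_left_mem_of_le 𝒮 hf hd] at ha'
      refine ⟨_, ?_, ha'⟩
      rw [intPiece, if_pos (by omega), show (j - d).toNat = j.toNat - d by omega]
      exact SetLike.coe_mem _
    · rw [coe_decompose_mul_of_left_mem_of_not_le 𝒮 hf hd] at ha'
      exact ⟨0, Submodule.zero_mem _, by rw [mul_zero]; exact ha'⟩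
  · have ha0 : a = 0 := by
      rwa [intPiece, if_neg hj, Submodule.mem_bot] at ha
    exact ⟨0, I.zero_mem, Submodule.zero_mem _, 0, Submodule.zero_mem _, by simp [ha0]⟩

theorem exists_decomposition_of_mem_sup {I : Ideal (MvPolynomial (Fin n) k)}
    (hI : I.IsHomogeneous 𝒮) {f : MvPolynomial (Fin n) k} {d : ℕ} (hf : f ∈ 𝒮 d)
    {s : Finset (Fin n)} {j : ℤ} {u : Laurent k n}
    (hu : u ∈ laurentPiece (I ⊔ Ideal.span {f}) s j) :
    ∃ u' ∈ laurentPiece I s j, ∃ v ∈ laurentPiece ⊤ s (j - d), u = u' + toLaurent k n f * v := by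
  obtain ⟨N, a, haI, ha, hau⟩ := hu
  obtain ⟨b, hbI, hb, w, hw, rfl⟩ := exists_homogeneous_decomposition hI hf ha haI
  obtain ⟨y, hy⟩ := ((isUnit_toLaurent_varProd (k := k) s).pow N).exists_left_inv
  rw [← map_pow] at hy
  refine ⟨u - toLaurent k n f * (toLaurent k n w * y), ⟨N, b, hbI, hb, ?_⟩,
    toLaurent k n w * y, ⟨N, w, trivial, ?_, ?_⟩, by ring⟩
  · rw [sub_mul, hau, map_add, map_mul, mul_assoc, mul_assoc, hy]
    ring
  · convert hw using 2
    ring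
  · rw [mul_assoc, hy, mul_one]

/-- One step of the long exact sequence for multiplication by a nonzerodivisor: vanishing. -/
theorem cechVanishes_sup {I : Ideal (MvPolynomial (Fin n) k)}
    (hI : I.IsHomogeneous 𝒮) {f : MvPolynomial (Fin n) k} {d : ℕ} (hf : f ∈ 𝒮 d)
    (hreg : ∀ a, f * a ∈ I → a ∈ I) {i : ℕ} {j : ℤ} (h1 : CechVanishes I (i + 1) (j - d))
    (h0 : CechVanishes I i j) : CechVanishes (I ⊔ Ideal.span {f}) i j := by
  intro c hc hci hdc
  -- The connecting map: write `dc = u' + f v` with `u'` in `I`, where `v` represents the image of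
  -- the class of `c`. Choosing `v = 0` off cardinality `i + 1` keeps it a cochain of that degree.
  have hex : ∀ s, ∃ u' ∈ laurentPiece I s j, ∃ v ∈ laurentPiece ⊤ s (j - d),
      simplexD _ n c s = u' + toLaurent k n f * v ∧ (s.card ≠ i + 1 → v = 0) := by
    intro s
    by_cases hs : s.card = i + 1
    · obtain ⟨u', hu', v, hv, h⟩ := exists_decomposition_of_mem_sup hI hf (hdc s)
      exact ⟨u', hu', v, hv, h, fun h => absurd hs h⟩
    · exact ⟨0, AddSubgroup.zero_mem _, 0, AddSubgroup.zero_mem _,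
        by simp [simplexD_eq_zero_of_card_ne hci hs], fun _ => rfl⟩
  choose u' hu' v hv huv hvi using hex
  -- From `d² = 0`, `f dv = -du'` lies in `I`, and `f` can be cancelled.
  have hdv : ∀ s, simplexD _ n v s ∈ laurentPiece I s (j - d) := by
    intro s
    refine mem_laurentPiece_of_toLaurent_mul hreg (simplexD_mem_laurentPiece hv s) (j' := j) ?_
    have h2 : simplexD _ n c = u' + fun s => toLaurent k n f * v s := funext huv
    have h3 := congrFun (simplexD_simplexD c) s
    rw [h2, map_add, simplexD_mul, Pi.add_apply, Pi.zero_apply] at h3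
    rw [eq_neg_of_add_eq_zero_right h3]
    exact AddSubgroup.neg_mem _ (simplexD_mem_laurentPiece hu' s)
  obtain ⟨w, hw, hwi, hvw⟩ := h1 v hv hvi hdv
  have hfw : ∀ {J : Ideal (MvPolynomial (Fin n) k)}, f ∈ J →
      ∀ s, toLaurent k n f * w s ∈ laurentPiece J s j := by
    intro J hJ s
    have := toLaurent_mul_mem_laurentPiece hf (fun a _ => J.mul_mem_left a hJ) (hw s)
    rwa [sub_add_cancel] at this
  -- Since `v = dw` modulo `I`, the corrected cochain `c - f w` is a cocycle modulo `I` and agrees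
  -- with `c` modulo `f`.
  obtain ⟨b, hb, hbi, hcb⟩ := h0 (c - fun s => toLaurent k n f * w s)
    (fun s => AddSubgroup.sub_mem _ (hc s) (hfw (Submodule.mem_top (x := f)) s))
    (fun s hs => by
      rw [Pi.sub_apply, hci s hs, hwi s (by omega), mul_zero, sub_zero])
    (fun s => by
      have h2 : simplexD _ n (c - fun s => toLaurent k n f * w s) s =
          u' s + toLaurent k n f * (v s - simplexD _ n w s) := by
        rw [map_sub, simplexD_mul, Pi.sub_apply, huv]
        ring
      rw [h2]
      have h3 := toLaurent_mul_mem_laurentPiece hf (fun a ha => I.mul_mem_right f ha) (hvw s)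
      rw [sub_add_cancel] at h3
      exact AddSubgroup.add_mem _ (hu' s) h3)
  refine ⟨b, hb, hbi, fun s => ?_⟩
  have h2 := AddSubgroup.add_mem _ (laurentPiece_mono_ideal le_sup_left s j (hcb s))
    (hfw (J := I ⊔ Ideal.span {f})
      (Ideal.mem_sup_right (Ideal.mem_span_singleton_self f)) s)
  convert h2 using 1
  simp only [Pi.sub_apply]
  ring

/-- One step of the long exact sequence for multiplication by a nonzerodivisor: nonvanishing. -/
theorem not_cechVanishes_sup {I : Ideal (MvPolynomial (Fin n) k)}
    (hI : I.IsHomogeneous 𝒮) {f : MvPolynomial (Fin n) k} {d : ℕ} (hf : f ∈ 𝒮 d)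
    (hreg : ∀ a, f * a ∈ I → a ∈ I) {i : ℕ} {j : ℤ} (h1 : ¬ CechVanishes I (i + 1) j)
    (h0 : CechVanishes I (i + 1) (j + d)) : ¬ CechVanishes (I ⊔ Ideal.span {f}) i (j + d) := by
  intro h
  refine h1 fun v hv hvi hdv => ?_
  have hfv : ∀ s, toLaurent k n f * v s ∈ laurentPiece ⊤ s (j + d) := fun s =>
    toLaurent_mul_mem_laurentPiece hf (fun _ _ => Submodule.mem_top) (hv s)
  -- Multiplication by `f` kills the class of `v`, so `f v = dw` modulo `I`. Then `w` is a cocycle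
  -- modulo `I + (f)`, the candidate lift of `v` under the connecting map.
  obtain ⟨w, hw, hwi, hvw⟩ := h0 (fun s => toLaurent k n f * v s) hfv
    (fun s hs => by rw [hvi s hs, mul_zero])
    (fun s => by
      rw [simplexD_mul]
      exact toLaurent_mul_mem_laurentPiece hf (fun a ha => I.mul_mem_right f ha) (hdv s))
  obtain ⟨b, hb, hbi, hwb⟩ := h w hw (fun s hs => hwi s (by omega)) fun s => by
    have h2 := AddSubgroup.sub_mem _ (toLaurent_mul_mem_laurentPiece hf
      (J := I ⊔ Ideal.span {f}) (fun a _ => Ideal.mem_sup_right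
        (Ideal.mul_mem_left _ a (Ideal.mem_span_singleton_self f))) (hv s))
      (laurentPiece_mono_ideal le_sup_left s _ (hvw s))
    rwa [sub_sub_cancel] at h2
  -- If `w` bounds modulo `I + (f)`, then `w = db + u' + f y`; applying `d` gives `f (v - dy)` in
  -- `I`, so `v` is already a boundary modulo `I`.
  have hex : ∀ s, ∃ u' ∈ laurentPiece I s (j + d), ∃ y ∈ laurentPiece ⊤ s j,
      w s - simplexD _ n b s = u' + toLaurent k n f * y ∧ (s.card + 1 ≠ i + 1 → y = 0) := by
    intro s
    by_cases hs : s.card + 1 = i + 1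
    · obtain ⟨u', hu', y, hy, h⟩ := exists_decomposition_of_mem_sup hI hf (hwb s)
      rw [add_sub_cancel_right] at hy
      exact ⟨u', hu', y, hy, h, fun h => absurd hs h⟩
    · refine ⟨0, AddSubgroup.zero_mem _, 0, AddSubgroup.zero_mem _, ?_, fun _ => rfl⟩
      rw [hwi s hs, simplexD_apply, Finset.sum_eq_zero, sub_zero, mul_zero, add_zero]
      intro l hl
      rw [hbi, mul_zero]
      have := Finset.card_erase_add_one hl
      omega
  choose u' hu' y hy huy hyi using hex
  refine ⟨y, hy, hyi, fun s => ?_⟩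
  refine mem_laurentPiece_of_toLaurent_mul hreg (j' := j + d)
    (AddSubgroup.sub_mem _ (hv s) (simplexD_mem_laurentPiece hy s)) ?_
  have h2 : simplexD _ n w s = simplexD _ n u' s + toLaurent k n f * simplexD _ n y s := by
    have h3 : w = simplexD _ n b + (u' + fun s => toLaurent k n f * y s) := by
      funext s
      rw [Pi.add_apply, Pi.add_apply, ← huy]
      ring
    rw [h3, map_add, simplexD_simplexD, zero_add, map_add, simplexD_mul]
    rfl
  have h4 := AddSubgroup.add_mem _ (hvw s) (simplexD_mem_laurentPiece hu' s)
  convert h4 using 1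
  rw [h2]
  ring

theorem span_image_Iio_succ {A : Type*} [CommRing A] (f : ℕ → A) (t : ℕ) :
    Ideal.span (f '' Set.Iio (t + 1)) = Ideal.span (f '' Set.Iio t) ⊔ Ideal.span {f t} := by
  rw [← Ideal.span_union, ← Set.image_singleton, ← Set.image_union]
  congr 2
  ext i
  simp

/-- The Čech cohomology of a graded complete intersection `S / (f_1, …, f_t)`: it vanishes below
degree `n - t`, and its top nonvanishing degree in cohomological degree `n - t` is
`∑ deg f_i - n`. -/
theorem cech_of_regular_sequence {t : ℕ} (ht : t ≤ n) (f : ℕ → MvPolynomial (Fin n) k)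
    (d : ℕ → ℕ) (hf : ∀ i < t, f i ∈ 𝒮 (d i)) (hd : ∀ i < t, 0 < d i)
    (hreg : ∀ i < t, ∀ a, f i * a ∈ Ideal.span (f '' Set.Iio i) → a ∈ Ideal.span (f '' Set.Iio i)) :
    (∀ i j, i + t < n → CechVanishes (Ideal.span (f '' Set.Iio t)) i j) ∧
    (∀ j, -(n : ℤ) + ∑ i ∈ Finset.range t, (d i : ℤ) < j →
      CechVanishes (Ideal.span (f '' Set.Iio t)) (n - t) j) ∧
    ¬ CechVanishes (Ideal.span (f '' Set.Iio t)) (n - t)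
      (-(n : ℤ) + ∑ i ∈ Finset.range t, (d i : ℤ)) := by
  induction t with
  | zero =>
    have h0 : Ideal.span (f '' Set.Iio 0) = ⊥ := by
      simp
    rw [h0]
    simp only [add_zero, Nat.sub_zero, Finset.range_zero, Finset.sum_empty]
    exact ⟨fun i j hi => cechVanishes_bot_of_lt hi j, fun j hj => cechVanishes_bot_of_gt hj,
      not_cechVanishes_bot⟩
  | succ t ih =>
    obtain ⟨hA, hB, hC⟩ := ih (by omega) (fun i hi => hf i (by omega))
      (fun i hi => hd i (by omega)) fun i hi => hreg i (by omega)
    have hI : (Ideal.span (f '' Set.Iio t)).IsHomogeneous 𝒮 := by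
      refine Ideal.homogeneous_span 𝒮 _ ?_
      rintro _ ⟨i, hi, rfl⟩
      exact ⟨d i, hf i (by simp at hi; omega)⟩
    have hft := hf t (by omega)
    have hrt := hreg t (by omega)
    have hdt := hd t (by omega)
    have hnt : n - (t + 1) + 1 = n - t := by omega
    rw [span_image_Iio_succ, Finset.sum_range_succ]
    refine ⟨fun i j hi => ?_, fun j hj => ?_, ?_⟩
    · exact cechVanishes_sup hI hft hrt (hA _ _ (by omega)) (hA _ _ (by omega))
    · refine cechVanishes_sup hI hft hrt ?_ (hA _ _ (by omega))
      rw [hnt]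
      exact hB _ (by omega)
    · rw [← add_assoc]
      refine not_cechVanishes_sup hI hft hrt ?_ ?_
      · rwa [hnt]
      -- Positivity of `d t` places the shifted degree strictly above the previous top degree, so
      -- vanishing applies there.
      · rw [hnt]
        exact hB _ (by omega)

end CechStep

/-! ### Comparing the Čech complex of `R` with Laurent lifts. -/

section Transport

open MvPolynomial

variable {k : Type v} [Field k] {R : Type u} [CommRing R] [Algebra k R] (𝒜 : ℕ → Submodule k R)
  {n : ℕ} (φ : MvPolynomial (Fin n) k →ₐ[k] R) (x : Fin n → 𝒜 1)

theorem awayMap_algebraMap {A : Type u} [CommRing A] {a b : A} (h : a ∣ b) (r : A) :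
    awayMap h (algebraMap A _ r) = algebraMap A _ r :=
  IsLocalization.Away.lift_eq _ _ r

/-- The fraction `u = a / x_s ^ N` of Laurent polynomials has image `z = φ a / φ (x_s) ^ N`. -/
def FractionRel (s : Finset (Fin n)) (u : Laurent k n) (z : CechLoc 𝒜 x s) : Prop :=
  ∃ (N : ℕ) (a : MvPolynomial (Fin n) k),
    u * toLaurent k n (varProd k s ^ N) = toLaurent k n a ∧
    z * algebraMap R _ (cechProd 𝒜 x s ^ N) = algebraMap R _ (φ a)

variable {φ x}

theorem map_varProd (hx : ∀ i, (x i : R) = φ (X i)) (s : Finset (Fin n)) :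
    φ (varProd k s) = cechProd 𝒜 x s := by
  rw [varProd, cechProd, map_prod]
  exact Finset.prod_congr rfl fun i _ => (hx i).symm

theorem isUnit_algebraMap_cechProd_pow (s : Finset (Fin n)) (N : ℕ) :
    IsUnit (algebraMap R (CechLoc 𝒜 x s) (cechProd 𝒜 x s ^ N)) := by
  rw [map_pow]
  exact (IsLocalization.Away.algebraMap_isUnit _).pow N

namespace FractionRel

variable {𝒜} {s : Finset (Fin n)} {u w : Laurent k n} {z y : CechLoc 𝒜 x s}

theorem zero : FractionRel 𝒜 φ x s 0 0 :=
  ⟨0, 0, by simp, by simp⟩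

theorem neg (h : FractionRel 𝒜 φ x s u z) : FractionRel 𝒜 φ x s (-u) (-z) := by
  obtain ⟨N, a, h1, h2⟩ := h
  exact ⟨N, -a, by rw [neg_mul, h1, map_neg], by rw [neg_mul, h2, map_neg, map_neg]⟩

theorem add (hx : ∀ i, (x i : R) = φ (X i)) (h : FractionRel 𝒜 φ x s u z)
    (h' : FractionRel 𝒜 φ x s w y) : FractionRel 𝒜 φ x s (u + w) (z + y) := by
  obtain ⟨N, a, h1, h2⟩ := h
  obtain ⟨M, b, h3, h4⟩ := h'
  refine ⟨N + M, a * varProd k s ^ M + b * varProd k s ^ N, ?_, ?_⟩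
  · rw [map_add, map_mul, map_mul, ← h1, ← h3, pow_add, map_mul]
    ring
  · rw [map_add, map_add, map_mul, map_mul, map_mul, map_mul, ← h2, ← h4, pow_add, map_mul,
      map_pow φ, map_pow φ, map_varProd 𝒜 hx]
    ring

theorem sub (hx : ∀ i, (x i : R) = φ (X i)) (h : FractionRel 𝒜 φ x s u z)
    (h' : FractionRel 𝒜 φ x s w y) : FractionRel 𝒜 φ x s (u - w) (z - y) := by
  rw [sub_eq_add_neg, sub_eq_add_neg]
  exact h.add hx h'.neg

/-- The relation does not depend on the chosen fraction: two numerators of `u` agree after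
cross-multiplication in `S`, and `x_s` is invertible in the target. -/
theorem mul_algebraMap (hx : ∀ i, (x i : R) = φ (X i)) (h : FractionRel 𝒜 φ x s u z) {M : ℕ}
    {b : MvPolynomial (Fin n) k} (hb : u * toLaurent k n (varProd k s ^ M) = toLaurent k n b) :
    z * algebraMap R _ (cechProd 𝒜 x s ^ M) = algebraMap R _ (φ b) := by
  obtain ⟨N, a, h1, h2⟩ := h
  have h3 : a * varProd k s ^ M = b * varProd k s ^ N := by
    apply toLaurent_injective
    rw [map_mul, map_mul, ← h1, ← hb]
    ring
  have h4 := congrArg (fun c => algebraMap R (CechLoc 𝒜 x s) (φ c)) h3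
  simp only [map_mul φ, map_pow φ, map_varProd 𝒜 hx] at h4
  rw [map_mul, map_mul, ← h2] at h4
  refine (isUnit_algebraMap_cechProd_pow 𝒜 s N).mul_right_cancel ?_
  rw [← h4]
  ring

/-- A fraction vanishes in `R_{x_s}` exactly when a power of `x_s` kills its numerator; absorbing
that power into the lift moves the numerator into `ker φ`. -/
theorem eq_zero_iff (hx : ∀ i, (x i : R) = φ (X i)) (h : FractionRel 𝒜 φ x s u z) {j : ℤ}
    (hu : u ∈ laurentPiece ⊤ s j) : z = 0 ↔ u ∈ laurentPiece (RingHom.ker φ) s j := by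
  constructor
  · rintro rfl
    obtain ⟨M, b, -, hb, hub⟩ := hu
    have h1 := h.mul_algebraMap hx hub
    rw [zero_mul] at h1
    obtain ⟨⟨_, m, rfl⟩, hm⟩ := (IsLocalization.map_eq_zero_iff
      (Submonoid.powers (cechProd 𝒜 x s)) (CechLoc 𝒜 x s) (φ b)).1 h1.symm
    refine ⟨M + m, b * varProd k s ^ m, ?_, ?_, ?_⟩
    · rw [RingHom.mem_ker, map_mul, map_pow, map_varProd 𝒜 hx, mul_comm]
      exact hm
    · have h := intPiece_mul _ hb (SetLike.pow_mem_graded m (varProd_mem s))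
      convert h using 2
      push_cast [smul_eq_mul]
      ring
    · rw [pow_add, map_mul, ← mul_assoc, hub, ← map_mul]
  · rintro ⟨M, b, hbI, -, hub⟩
    have h1 := h.mul_algebraMap hx hub
    rw [(RingHom.mem_ker).1 hbI, map_zero] at h1
    exact (isUnit_algebraMap_cechProd_pow 𝒜 s M).mul_left_eq_zero.1 h1

theorem awayMap (hx : ∀ i, (x i : R) = φ (X i)) (i : Fin n) {z : CechLoc 𝒜 x (s.erase i)}
    (h : FractionRel 𝒜 φ x (s.erase i) u z) :
    FractionRel 𝒜 φ x s u (DiagF.awayMap (cechProd_erase_dvd 𝒜 x s i) z) := by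
  obtain ⟨N, a, h1, h2⟩ := h
  have hprod : varProd k s = varProd k (s \ s.erase i) * varProd k (s.erase i) :=
    (Finset.prod_sdiff (Finset.erase_subset i s)).symm
  refine ⟨N, a * varProd k (s \ s.erase i) ^ N, ?_, ?_⟩
  · rw [map_mul, ← h1, hprod, mul_pow, map_mul]
    ring
  · have h3 := congrArg (DiagF.awayMap (cechProd_erase_dvd 𝒜 x s i)) h2
    rw [map_mul, awayMap_algebraMap, awayMap_algebraMap] at h3
    have h4 : cechProd 𝒜 x s ^ N =
        cechProd 𝒜 x (s.erase i) ^ N * φ (varProd k (s \ s.erase i) ^ N) := by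
      rw [← map_varProd 𝒜 hx s, hprod, map_mul φ, mul_pow, map_pow φ, map_varProd 𝒜 hx (s.erase i)]
      ring
    rw [h4, map_mul φ, map_mul, map_mul, ← h3]
    ring

theorem cechD (hx : ∀ i, (x i : R) = φ (X i)) {c : Finset (Fin n) → Laurent k n}
    {c' : ∀ s : Finset (Fin n), CechLoc 𝒜 x s} (h : ∀ s, FractionRel 𝒜 φ x s (c s) (c' s))
    (s : Finset (Fin n)) :
    FractionRel 𝒜 φ x s (simplexD _ n c s) (DiagF.cechD 𝒜 x c' s) := by
  rw [simplexD_apply]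
  change FractionRel 𝒜 φ x s _ (∑ i ∈ s, (-1) ^ (s.filter (· < i)).card *
    DiagF.awayMap (cechProd_erase_dvd 𝒜 x s i) (c' (s.erase i)))
  -- Freeze the sign exponents, which depend on `s`, so that induction can run over the summation
  -- set alone.
  generalize hT : (fun i => (s.filter (· < i)).card) = m
  have hT' : ∀ i, (s.filter (· < i)).card = m i := fun i => congrFun hT i
  simp only [cechSign, hT']
  suffices ∀ T : Finset (Fin n), FractionRel 𝒜 φ x s
      (∑ i ∈ T, (-1) ^ m i * c (s.erase i))
      (∑ i ∈ T, (-1) ^ m i *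
        DiagF.awayMap (cechProd_erase_dvd 𝒜 x s i) (c' (s.erase i))) from this s
  intro T
  induction T using Finset.induction_on with
  | empty => exact zero
  | insert i T hi ih =>
    rw [Finset.sum_insert hi, Finset.sum_insert hi]
    refine add hx ?_ ih
    have h1 := (h (s.erase i)).awayMap hx
    rcases (m i).even_or_odd with he | he
    · rw [he.neg_one_pow, he.neg_one_pow, one_mul, one_mul]
      exact h1
    · rw [he.neg_one_pow, he.neg_one_pow, neg_one_mul, neg_one_mul]
      exact h1.neg

end FractionRel

variable [GradedAlgebra 𝒜]

theorem map_mem_intPiece (hX : ∀ i, φ (X i) ∈ 𝒜 1) {j : ℤ} {a : MvPolynomial (Fin n) k}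
    (ha : a ∈ intPiece (homogeneousSubmodule (Fin n) k) j) : φ a ∈ intPiece 𝒜 j := by
  unfold intPiece at *
  split_ifs at *
  · exact map_mem_piece 𝒜 hX ha
  · rw [(Submodule.mem_bot _).1 ha, map_zero]
    exact Submodule.zero_mem _

theorem exists_preimage_intPiece (hφ : Function.Surjective φ) (hX : ∀ i, φ (X i) ∈ 𝒜 1) {j : ℤ}
    {r : R} (hr : r ∈ intPiece 𝒜 j) :
    ∃ a ∈ intPiece (homogeneousSubmodule (Fin n) k) j, φ a = r := by
  unfold intPiece at *
  split_ifs at *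
  · exact exists_preimage_piece 𝒜 hφ hX hr
  · exact ⟨0, Submodule.zero_mem _, by rw [map_zero, (Submodule.mem_bot _).1 hr]⟩

theorem exists_fractionRel_of_mem_cechLocPiece (hφ : Function.Surjective φ)
    (hx : ∀ i, (x i : R) = φ (X i)) {s : Finset (Fin n)} {j : ℤ} {z : CechLoc 𝒜 x s}
    (hz : z ∈ cechLocPiece 𝒜 x s j) : ∃ u ∈ laurentPiece ⊤ s j, FractionRel 𝒜 φ x s u z := by
  obtain ⟨N, r, hr, hzr⟩ := hz
  obtain ⟨a, ha, rfl⟩ := exists_preimage_intPiece 𝒜 hφ (fun i => hx i ▸ (x i).2) hr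
  obtain ⟨y, hy⟩ := ((isUnit_toLaurent_varProd (k := k) s).pow N).exists_left_inv
  rw [← map_pow] at hy
  have h : toLaurent k n a * y * toLaurent k n (varProd k s ^ N) = toLaurent k n a := by
    rw [mul_assoc, hy, mul_one]
  exact ⟨toLaurent k n a * y, ⟨N, a, trivial, ha, h⟩, N, a, h, hzr⟩

theorem exists_fractionRel_of_mem_laurentPiece (hx : ∀ i, (x i : R) = φ (X i))
    {s : Finset (Fin n)} {j : ℤ} {u : Laurent k n} (hu : u ∈ laurentPiece ⊤ s j) :
    ∃ z ∈ cechLocPiece 𝒜 x s j, FractionRel 𝒜 φ x s u z := by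
  obtain ⟨N, a, -, ha, hua⟩ := hu
  obtain ⟨y, hy⟩ := (isUnit_algebraMap_cechProd_pow 𝒜 (x := x) s N).exists_left_inv
  have h : algebraMap R (CechLoc 𝒜 x s) (φ a) * y * algebraMap R _ (cechProd 𝒜 x s ^ N) =
      algebraMap R _ (φ a) := by
    rw [mul_assoc, hy, mul_one]
  exact ⟨_, ⟨N, φ a, map_mem_intPiece 𝒜 (fun i => hx i ▸ (x i).2) ha, h⟩, N, a, hua, h⟩

/-- Phrasing the support as `s.card + 1 ≠ i` covers `i = 0` uniformly, where it forces `b = 0`. -/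
theorem mem_cechCoboundaries_iff {i : ℕ} {j : ℤ} {z : ∀ s : Finset (Fin n), CechLoc 𝒜 x s} :
    z ∈ cechCoboundaries 𝒜 x i j ↔ ∃ b : ∀ s : Finset (Fin n), CechLoc 𝒜 x s,
      (∀ s, b s ∈ cechLocPiece 𝒜 x s j) ∧ (∀ s, s.card + 1 ≠ i → b s = 0) ∧ cechD 𝒜 x b = z := by
  cases i with
  | zero =>
    rw [cechCoboundaries, AddSubgroup.mem_bot]
    constructor
    · rintro rfl
      exact ⟨0, fun s => AddSubgroup.zero_mem _, fun _ _ => rfl, map_zero _⟩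
    · rintro ⟨b, -, hb, rfl⟩
      rw [show b = 0 from funext fun s => hb s (Nat.succ_ne_zero _), map_zero]
  | succ i =>
    simp only [Nat.add_right_cancel_iff, ne_eq]
    exact ⟨fun ⟨b, hb, h⟩ => ⟨b, hb.1, hb.2, h⟩, fun ⟨b, hb, hb', h⟩ => ⟨b, ⟨hb, hb'⟩, h⟩⟩

theorem cechCocycles_le_cechCoboundaries_iff (hφ : Function.Surjective φ)
    (hx : ∀ i, (x i : R) = φ (X i)) (i : ℕ) (j : ℤ) :
    cechCocycles 𝒜 x i j ≤ cechCoboundaries 𝒜 x i j ↔ CechVanishes (RingHom.ker φ) i j := by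
  -- The predicate `P` prescribes the cardinalities where the cochain is zero, so one statement
  -- serves both cocycles and their primitives.
  have lift : ∀ (P : ℕ → Prop) (z : ∀ s : Finset (Fin n), CechLoc 𝒜 x s),
      (∀ s, z s ∈ cechLocPiece 𝒜 x s j) → (∀ s, P s.card → z s = 0) →
      ∃ c : Finset (Fin n) → Laurent k n, (∀ s, c s ∈ laurentPiece ⊤ s j) ∧
        (∀ s, P s.card → c s = 0) ∧ ∀ s, FractionRel 𝒜 φ x s (c s) (z s) := by
    intro P z hz hP
    have : ∀ s, ∃ u ∈ laurentPiece ⊤ s j, (P s.card → u = 0) ∧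
        FractionRel 𝒜 φ x s u (z s) := by
      intro s
      by_cases hs : P s.card
      · exact ⟨0, AddSubgroup.zero_mem _, fun _ => rfl, by rw [hP s hs]; exact .zero⟩
      · obtain ⟨u, hu, h⟩ := exists_fractionRel_of_mem_cechLocPiece 𝒜 hφ hx (hz s)
        exact ⟨u, hu, fun h => absurd h hs, h⟩
    choose c hc hcP hcz using this
    exact ⟨c, hc, hcP, hcz⟩
  have push : ∀ (P : ℕ → Prop) (c : Finset (Fin n) → Laurent k n),
      (∀ s, c s ∈ laurentPiece ⊤ s j) → (∀ s, P s.card → c s = 0) →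
      ∃ z : ∀ s : Finset (Fin n), CechLoc 𝒜 x s, (∀ s, z s ∈ cechLocPiece 𝒜 x s j) ∧
        (∀ s, P s.card → z s = 0) ∧ ∀ s, FractionRel 𝒜 φ x s (c s) (z s) := by
    intro P c hc hP
    have : ∀ s, ∃ z ∈ cechLocPiece 𝒜 x s j, (P s.card → z = 0) ∧
        FractionRel 𝒜 φ x s (c s) z := by
      intro s
      by_cases hs : P s.card
      · exact ⟨0, AddSubgroup.zero_mem _, fun _ => rfl, by rw [hP s hs]; exact .zero⟩
      · obtain ⟨z, hz, h⟩ := exists_fractionRel_of_mem_laurentPiece 𝒜 hx (hc s)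
        exact ⟨z, hz, fun h => absurd h hs, h⟩
    choose z hz hzP hcz using this
    exact ⟨z, hz, hzP, hcz⟩
  constructor
  · intro hle c hc hci hdc
    obtain ⟨z, hz, hzi, hcz⟩ := push (· ≠ i) c hc hci
    have hdz : cechD 𝒜 x z = 0 := by
      funext s
      have h1 := FractionRel.cechD hx hcz s
      have h2 := simplexD_mem_laurentPiece hc s
      have h3 := h1.eq_zero_iff hx h2
      exact h3.2 (hdc s)
    have hmem : z ∈ cechCocycles 𝒜 x i j :=
      AddSubgroup.mem_inf.2 ⟨⟨hz, hzi⟩, AddMonoidHom.mem_ker.2 hdz⟩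
    obtain ⟨b', hb', hbi', hbz⟩ := (mem_cechCoboundaries_iff 𝒜).1 (hle hmem)
    obtain ⟨b, hb, hbi, hbb⟩ := lift (fun m => m + 1 ≠ i) b' hb' hbi'
    refine ⟨b, hb, hbi, fun s => ?_⟩
    refine (((hcz s).sub hx (FractionRel.cechD hx hbb s)).eq_zero_iff hx
      (AddSubgroup.sub_mem _ (hc s) (simplexD_mem_laurentPiece hb s))).1 ?_
    rw [hbz, sub_self]
  · rintro hv z ⟨⟨hz, hzi⟩, hdz⟩
    replace hdz : cechD 𝒜 x z = 0 := AddMonoidHom.mem_ker.1 hdz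
    obtain ⟨c, hc, hci, hcz⟩ := lift (· ≠ i) z hz hzi
    obtain ⟨b, hb, hbi, hcb⟩ := hv c hc hci fun s =>
      ((FractionRel.cechD hx hcz s).eq_zero_iff hx (simplexD_mem_laurentPiece hc s)).1
        (congrFun hdz s)
    obtain ⟨b', hb', hbi', hbb⟩ := push (fun m => m + 1 ≠ i) b hb hbi
    refine (mem_cechCoboundaries_iff 𝒜).2 ⟨b', hb', hbi', funext fun s => ?_⟩
    refine (sub_eq_zero.1 ?_).symm
    exact (((hcz s).sub hx (FractionRel.cechD hx hbb s)).eq_zero_iff hx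
      (AddSubgroup.sub_mem _ (hc s) (simplexD_mem_laurentPiece hb s))).2 (hcb s)

theorem nontrivial_cechCohomology_iff (hφ : Function.Surjective φ)
    (hx : ∀ i, (x i : R) = φ (X i)) (i : ℕ) (j : ℤ) :
    Nontrivial (CechCohomology 𝒜 x i j) ↔ ¬ CechVanishes (RingHom.ker φ) i j := by
  rw [← cechCocycles_le_cechCoboundaries_iff 𝒜 hφ hx, ← AddSubgroup.addSubgroupOf_eq_top,
    ← not_subsingleton_iff_nontrivial, not_iff_not]
  exact QuotientAddGroup.subsingleton_iff

end Transport

/-! ### Krull dimension of a complete intersection. -/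

section Dimension

open MvPolynomial

variable {k : Type v} [Field k] {n : ℕ}

local notation "𝒮" => homogeneousSubmodule (Fin n) k

theorem ringKrullDim_quotient_sup_span_singleton_add_one_le {A : Type*} [CommRing A] {I : Ideal A}
    {f : A} (hreg : ∀ a, f * a ∈ I → a ∈ I) :
    ringKrullDim (A ⧸ I ⊔ Ideal.span {f}) + 1 ≤ ringKrullDim (A ⧸ I) := by
  have h1 : Ideal.Quotient.mk I f ∈ nonZeroDivisors (A ⧸ I) := by
    rw [mem_nonZeroDivisors_iff_right]
    intro y hy
    obtain ⟨a, rfl⟩ := Ideal.Quotient.mk_surjective y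
    rw [← map_mul, Ideal.Quotient.eq_zero_iff_mem] at hy
    exact Ideal.Quotient.eq_zero_iff_mem.2 (hreg a (mul_comm a f ▸ hy))
  have h2 := ringKrullDim_quotient_succ_le_of_nonZeroDivisor h1
  rwa [← Set.image_singleton, ← Ideal.map_span,
    ringKrullDim_eq_of_ringEquiv (DoubleQuot.quotQuotEquivQuotSup I (Ideal.span {f}))] at h2

theorem ringKrullDim_quotient_add_le {t : ℕ} (f : ℕ → MvPolynomial (Fin n) k)
    (hreg : ∀ i < t, ∀ a, f i * a ∈ Ideal.span (f '' Set.Iio i) → a ∈ Ideal.span (f '' Set.Iio i)) :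
    ringKrullDim (MvPolynomial (Fin n) k ⧸ Ideal.span (f '' Set.Iio t)) + t ≤ n := by
  induction t with
  | zero =>
    have h := ringKrullDim_quotient_le (Ideal.span (f '' Set.Iio 0))
    rw [MvPolynomial.ringKrullDim_of_isNoetherianRing, ringKrullDim_eq_zero_of_field] at h
    simpa using h
  | succ t ih =>
    have h := ringKrullDim_quotient_sup_span_singleton_add_one_le (hreg t (by omega))
    rw [← span_image_Iio_succ] at h
    refine le_trans ?_ (ih fun i hi => hreg i (by omega))
    rw [Nat.cast_add, Nat.cast_one, add_comm (t : WithBot ℕ∞) 1, ← add_assoc]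
    gcongr

/-- The endomorphism killing the first `m` variables. -/
noncomputable def killVars (k : Type v) [Field k] (n m : ℕ) :
    MvPolynomial (Fin n) k →ₐ[k] MvPolynomial (Fin n) k :=
  aeval fun i => if (i : ℕ) < m then 0 else X i

theorem killVars_killVars_succ (m : ℕ) (a : MvPolynomial (Fin n) k) :
    killVars k n (m + 1) (killVars k n m a) = killVars k n (m + 1) a := by
  rw [← AlgHom.comp_apply]
  congr 1
  ext1 i
  simp only [killVars, AlgHom.comp_apply, aeval_X]
  by_cases h1 : (i : ℕ) < m
  · rw [if_pos h1, if_pos (by omega), map_zero]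
  · rw [if_neg h1, aeval_X]

/-- The kernels form a strictly increasing chain of primes: `x_m` (counting from zero) enters at
stage `m + 1`. -/
theorem le_height_ker_killVars {m : ℕ} (hm : m ≤ n) :
    (m : ℕ∞) ≤ (RingHom.ker (killVars k n m)).height := by
  induction m with
  | zero => simp
  | succ m ih =>
    have hlt : RingHom.ker (killVars k n m) < RingHom.ker (killVars k n (m + 1)) := by
      rw [SetLike.lt_iff_le_and_exists]
      refine ⟨fun a ha => ?_, X ⟨m, hm⟩, ?_, ?_⟩
      · rw [RingHom.mem_ker] at ha ⊢
        rw [← killVars_killVars_succ, ha, map_zero]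
      · simp [killVars, RingHom.mem_ker]
      · simp [killVars, RingHom.mem_ker]
    have : (RingHom.ker (killVars k n m)).IsPrime := RingHom.ker_isPrime _
    have : (RingHom.ker (killVars k n (m + 1))).IsPrime := RingHom.ker_isPrime _
    rw [Nat.cast_add, Nat.cast_one]
    exact (add_le_add_left (ih (by omega)) 1).trans
      (Ideal.height_add_one_le_of_lt_of_isPrime hlt)

theorem maxIdeal_le_ker_killVars : maxIdeal 𝒮 ≤ RingHom.ker (killVars k n n) := by
  rw [← span_map_X 𝒮 (φ := AlgHom.id k _) Function.surjective_id
    (fun i => (mem_homogeneousSubmodule 1 _).2 (isHomogeneous_X k i)), Ideal.span_le]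
  rintro _ ⟨i, rfl⟩
  simp [killVars, RingHom.mem_ker]

/-- By Krull's height theorem, a prime containing `t` elements has height at most the dimension of
their quotient plus `t`; here the prime is the kernel killing all variables, of height at least `n`.
-/
theorem le_ringKrullDim_quotient_add {t : ℕ} {f : Fin t → MvPolynomial (Fin n) k}
    (hf : ∀ i, f i ∈ maxIdeal 𝒮) :
    (n : WithBot ℕ∞) ≤
      ringKrullDim (MvPolynomial (Fin n) k ⧸ Ideal.span (Set.range f)) + t := by
  have : (RingHom.ker (killVars k n n)).IsPrime := RingHom.ker_isPrime _
  have h1 := Ideal.height_le_ringKrullDim_quotient_add_encard (p := RingHom.ker (killVars k n n))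
    (Set.range f) (by
      rintro _ ⟨i, rfl⟩
      exact maxIdeal_le_ker_killVars (hf i))
  have h2 : (n : WithBot ℕ∞) ≤ ((RingHom.ker (killVars k n n)).height : WithBot ℕ∞) := by
    exact_mod_cast le_height_ker_killVars (k := k) (le_refl n)
  have h3 : (Set.range f).encard ≤ t := by
    rw [← Set.image_univ]
    refine (Set.encard_image_le _ _).trans ?_
    simp
  refine h2.trans (h1.trans ?_)
  gcongr
  exact_mod_cast h3

end Dimension

/-! ### Dimension and `a`-invariant from a presentation. -/

section CompleteIntersection

open MvPolynomial

variable {k : Type v} [Field k] {R : Type u} [CommRing R] [Algebra k R] {𝒜 : ℕ → Submodule k R}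
  {n t : ℕ} {φ : MvPolynomial (Fin n) k →ₐ[k] R} {f : Fin t → MvPolynomial (Fin n) k}
  {d : Fin t → ℕ}

/-- A finite sequence extended by zero. -/
def extendZero {A : Type*} [Zero A] {t : ℕ} (f : Fin t → A) (i : ℕ) : A :=
  if h : i < t then f ⟨i, h⟩ else 0

theorem extendZero_of_lt {A : Type*} [Zero A] (f : Fin t → A) {i : ℕ} (h : i < t) :
    extendZero f i = f ⟨i, h⟩ := dif_pos h

theorem image_extendZero {A : Type*} [Zero A] (f : Fin t → A) :
    extendZero f '' Set.Iio t = Set.range f := by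
  ext a
  constructor
  · rintro ⟨i, hi, rfl⟩
    exact ⟨⟨i, hi⟩, (extendZero_of_lt f hi).symm⟩
  · rintro ⟨i, rfl⟩
    exact ⟨i, i.2, extendZero_of_lt f i.2⟩

theorem mem_span_of_isWeaklyRegular {A : Type*} [CommRing A] {f : Fin t → A}
    (h : RingTheory.Sequence.IsWeaklyRegular A (List.ofFn f)) {i : ℕ} (hi : i < t) {a : A}
    (ha : extendZero f i * a ∈ Ideal.span (extendZero f '' Set.Iio i)) :
    a ∈ Ideal.span (extendZero f '' Set.Iio i) := by
  have h1 := h.regular_mod_prev i (by simpa using hi)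
  rw [isSMulRegular_quotient_iff_mem_of_smul_mem] at h1
  have h2 : (Ideal.ofList ((List.ofFn f).take i) • ⊤ : Submodule A A) =
      Ideal.span (extendZero f '' Set.Iio i) := by
    rw [smul_eq_mul, Ideal.mul_top, Ideal.ofList]
    congr 1
    ext b
    simp only [Set.mem_ofPred_eq, List.mem_take_iff_getElem, List.getElem_ofFn, List.length_ofFn]
    constructor
    · rintro ⟨j, hj, rfl⟩
      exact ⟨j, by simp at hj ⊢; omega, extendZero_of_lt f (by omega)⟩
    · rintro ⟨j, hj, rfl⟩
      have : j < i := hj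
      exact ⟨j, by omega, (extendZero_of_lt f (by omega)).symm⟩
  rw [h2] at h1
  refine h1 a ?_
  rwa [List.getElem_ofFn, smul_eq_mul, ← extendZero_of_lt f hi]

namespace IsCIPresentation

variable (h : IsCIPresentation 𝒜 φ f d)

include h

theorem mem_span_of_mul_mem {i : ℕ} (hi : i < t) {a : MvPolynomial (Fin n) k}
    (ha : extendZero f i * a ∈ Ideal.span (extendZero f '' Set.Iio i)) :
    a ∈ Ideal.span (extendZero f '' Set.Iio i) :=
  mem_span_of_isWeaklyRegular h.regular.toIsWeaklyRegular hi ha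

/-- A form of degree zero is a constant. If it is zero, regularity puts `1` in the span of the
earlier `f`; if not, a unit lies in `ker φ`. Either way `R` would be zero. -/
theorem degree_pos [Nontrivial R] (i : Fin t) : 0 < d i := by
  by_contra hd
  have h0 := h.homogeneous i
  rw [Nat.eq_zero_of_not_pos hd] at h0
  have h1 := totalDegree_eq_zero_iff_eq_C.1 (Nat.le_zero.1 h0.totalDegree_le)
  have hmem : f i ∈ RingHom.ker φ := by
    rw [h.ker_eq]
    exact Ideal.subset_span ⟨i, rfl⟩
  have hone : (1 : MvPolynomial (Fin n) k) ∉ RingHom.ker φ := by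
    rw [RingHom.mem_ker, map_one]
    exact one_ne_zero
  by_cases hc : coeff 0 (f i) = 0
  · rw [hc, map_zero] at h1
    have h2 := h.mem_span_of_mul_mem i.2 (a := 1) (by
      rw [extendZero_of_lt f i.2, h1, zero_mul]
      exact Ideal.zero_mem _)
    refine hone ?_
    rw [h.ker_eq, ← image_extendZero]
    exact Ideal.span_mono (Set.image_mono (Set.Iio_subset_Iio i.2.le)) h2
  · rw [h1, RingHom.mem_ker, ← MvPolynomial.algebraMap_eq, AlgHom.commutes,
      map_eq_zero_iff _ (algebraMap k R).injective] at hmem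
    exact hc hmem

theorem mem_maxIdeal [Nontrivial R] (i : Fin t) :
    f i ∈ maxIdeal (homogeneousSubmodule (Fin n) k) :=
  HomogeneousIdeal.mem_irrelevant_of_mem _ (h.degree_pos i)
    ((mem_homogeneousSubmodule _ _).2 (h.homogeneous i))

theorem ringKrullDim_eq [Nontrivial R] : t ≤ n ∧ ringKrullDim R = (n - t : ℕ) := by
  have e : ringKrullDim R = ringKrullDim (MvPolynomial (Fin n) k ⧸ Ideal.span (Set.range f)) := by
    rw [← h.ker_eq]
    exact (ringKrullDim_eq_of_ringEquiv
      (RingHom.quotientKerEquivOfSurjective (f := φ.toRingHom) h.surjective)).symm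
  have h1 := ringKrullDim_quotient_add_le (t := t) (extendZero f)
    fun i hi a => h.mem_span_of_mul_mem hi
  have h2 := le_ringKrullDim_quotient_add h.mem_maxIdeal
  rw [image_extendZero, ← e] at h1
  rw [← e] at h2
  have h3 : ringKrullDim R ≠ ⊥ :=
    ((WithBot.bot_lt_coe 0).trans_le ringKrullDim_nonneg_of_nontrivial).ne'
  generalize ringKrullDim R = D at *
  lift D to ℕ∞ using h3
  have h1' : D + t ≤ (n : ℕ∞) := by exact_mod_cast h1
  have h2' : (n : ℕ∞) ≤ D + t := by exact_mod_cast h2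
  have hD : D ≠ ⊤ := by
    rintro rfl
    simp at h1'
  lift D to ℕ using hD
  have h1'' : D + t ≤ n := by exact_mod_cast h1'
  have h2'' : n ≤ D + t := by exact_mod_cast h2'
  refine ⟨by omega, ?_⟩
  rw [show n - t = D by omega]
  rfl

/-- The `a`-invariant of a graded complete intersection. -/
theorem isAInvariant [GradedAlgebra 𝒜] [Nontrivial R] :
    IsAInvariant 𝒜 (-(n : ℤ) + ∑ i, (d i : ℤ)) := by
  obtain ⟨ht, hdim⟩ := h.ringKrullDim_eq
  have hsum : ∑ i ∈ Finset.range t, ((extendZero d i : ℕ) : ℤ) = ∑ i, (d i : ℤ) := by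
    rw [Finset.sum_range]
    exact Finset.sum_congr rfl fun i _ => by rw [extendZero_of_lt d i.2]
  obtain ⟨-, hB, hC⟩ := cech_of_regular_sequence ht (extendZero f) (extendZero d)
    (fun i hi => by
      rw [extendZero_of_lt f hi, extendZero_of_lt d hi, mem_homogeneousSubmodule]
      exact h.homogeneous _)
    (fun i hi => by
      rw [extendZero_of_lt d hi]
      exact h.degree_pos _)
    fun i hi a => h.mem_span_of_mul_mem hi
  rw [image_extendZero, ← h.ker_eq, hsum] at hB hC
  refine ⟨n, fun i => ⟨φ (X i), h.map_X i⟩, n - t, span_map_X 𝒜 h.surjective h.map_X, hdim,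
    (nontrivial_cechCohomology_iff 𝒜 h.surjective (fun _ => rfl) _ _).2 hC, fun j hj => ?_⟩
  by_contra! hlt
  exact (nontrivial_cechCohomology_iff 𝒜 h.surjective (fun _ => rfl) _ _).1 hj (hB j hlt)

end IsCIPresentation

end CompleteIntersection

end DiagF

/-! ### The proposition. -/

theorem proposition2p3 {k : Type v} [Field k] (p : ℕ) [Fact p.Prime] [CharP k p]
    {R : Type u} [CommRing R] [Algebra k R] (𝒜 : ℕ → Submodule k R) [GradedAlgebra 𝒜]
    (h𝒜 : DiagF.IsStandardGraded 𝒜)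
    (I : Ideal R) (hI : I.IsHomogeneous 𝒜) (hIm : I.radical = DiagF.maxIdeal 𝒜) :
    (DiagF.IsCompleteIntersection 𝒜 ∨ DiagF.IsFPureOnPuncturedSpectrum p 𝒜 →
      ∃ c : ℝ, DiagF.HasDiagonalFThreshold p 𝒜 I c) ∧
    (∀ (n t : ℕ) (φ : MvPolynomial (Fin n) k →ₐ[k] R) (f : Fin t → MvPolynomial (Fin n) k)
      (d : Fin t → ℕ), DiagF.IsCIPresentation 𝒜 φ f d →
      ∃ cR cS : ℝ, DiagF.HasDiagonalFThreshold p 𝒜 I cR ∧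
        DiagF.HasDiagonalFThreshold p (MvPolynomial.homogeneousSubmodule (Fin n) k)
          (I.comap φ) cS ∧
        cR ≥ cS - ∑ i, (d i : ℝ)) ∧
    (DiagF.IsCompleteIntersection 𝒜 →
      ∃ (c : ℝ) (a : ℤ), DiagF.HasDiagonalFThreshold p 𝒜 (DiagF.maxIdeal 𝒜) c ∧
        DiagF.IsAInvariant 𝒜 a ∧ c ≥ -(a : ℝ)) := by
  have : Nontrivial R := h𝒜.nontrivial
  have : ExpChar k p := ExpChar.prime Fact.out
  have : CharP R p := charP_of_injective_algebraMap (algebraMap k R).injective p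
  have : ExpChar R p := ExpChar.prime Fact.out
  have hCI : ∀ (I : Ideal R), I.IsHomogeneous 𝒜 → I.radical = DiagF.maxIdeal 𝒜 →
      ∀ (n t : ℕ) (φ : MvPolynomial (Fin n) k →ₐ[k] R) (f : Fin t → MvPolynomial (Fin n) k)
      (d : Fin t → ℕ), DiagF.IsCIPresentation 𝒜 φ f d →
      ∃ cR cS : ℝ, DiagF.HasDiagonalFThreshold p 𝒜 I cR ∧
        DiagF.HasDiagonalFThreshold p (MvPolynomial.homogeneousSubmodule (Fin n) k)
          (I.comap φ) cS ∧
        cR ≥ cS - ∑ i, (d i : ℝ) := by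
    intro I hI hIm n t φ f d h
    obtain ⟨cR, hR⟩ := DiagF.exists_hasDiagonalFThreshold p 𝒜 h.surjective h.map_X hIm
    obtain ⟨cS, hS⟩ := DiagF.exists_hasDiagonalFThreshold_mvPolynomial p
      (DiagF.radical_comap 𝒜 h.map_X hIm)
    exact ⟨cR, cS, hR, hS, DiagF.threshold_ge_sub_sum_degrees p 𝒜 h.surjective h.map_X
      h.homogeneous h.ker_eq hI hIm hR hS⟩
  refine ⟨fun _ => ?_, hCI I hI hIm, ?_⟩
  · obtain ⟨n, φ, hφ, hX⟩ := DiagF.exists_presentation 𝒜 h𝒜.finite_one h𝒜.adjoin_one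
    exact DiagF.exists_hasDiagonalFThreshold p 𝒜 hφ hX hIm
  · rintro ⟨n, t, φ, f, d, h⟩
    have hm : (DiagF.maxIdeal 𝒜).radical = DiagF.maxIdeal 𝒜 := by
      rw [← hIm, Ideal.radical_idem]
    obtain ⟨cR, cS, hR, hS, hle⟩ :=
      hCI (DiagF.maxIdeal 𝒜) (HomogeneousIdeal.isHomogeneous _) hm n t φ f d h
    rw [DiagF.comap_maxIdeal 𝒜 h.map_X] at hS
    -- With `c(S) ≥ n`, the comparison reads `c(R) ≥ n - ∑ d_i`, which is minus the computed
    -- `a`-invariant.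
    have hn := DiagF.card_le_threshold_maxIdeal p hS
    refine ⟨cR, _, hR, h.isAInvariant, ?_⟩
    push_cast
    linarith
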